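/- Work in the unit-cost RAM model: every arithmetic operation, comparison and memory access on natural or real numbers takes one time unit, and there is no rounding from reals to integers. There are a single algorithm, a constant $\kappa>0$ and a rational-valued function $g$ with $\kappa\,\delta/n\le g(n,\delta)<1$ (so $g(n,\delta)=\Omega(\delta/n)$) such that the following holds. Let $\mathcal S\subseteq 2^{[n]}$ be a family of sets with cost function $c:\mathcal S\to(0,1]$ such that every $i\in[n]$ lies in some $S\in\mathcal S$, and suppose that the algorithm has access to * a subroutine that evaluates $c(S)$ for $S\in\mathcal S$ in time $O(n)$, and * a subroutine that, given $y\in\mathbb Q_{\ge 0}^n$ and a rational $0<\varepsilon<1$, finds in time $T(n,\varepsilon)$ a set $S^*\in\mathcal S$ with $$\frac1{c(S^*)}\sum_{i\in S^*}y_i\ \ge\ (1-\varepsilon)\cdot\max\Big\{\frac1{c(S)}\sum_{i\in S}y_i\ \Big|\ S\in\mathcal S\Big\}.$$ A call of a subroutine costs its running time plus $O(n)$ for handing over the data; $T\ge 0$ is otherwise arbitrary. Then, given $n$ and any real $\delta$ with $0<\delta\le n/2$, the algorithm finds a basic feasible solution $x$ of the linear program $$OPT_f=\min\Big\{\sum_{S\in\mathcal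 S}c(S)\,x_S\ \Big|\ \sum_{S\in\mathcal S}x_S\mathbf 1_S\ge\mathbf 1,\ x\ge\mathbf 0\Big\}$$ with $\sum_{S}c(S)x_S\le OPT_f+\delta$, in time $$O\Big(\frac{n^4}{\delta^2}\ln\frac n\delta\Big)\cdot\Big(\frac1\delta\,T\big(n,g(n,\delta)\big)+n^2\Big).$$ The solution is output as a list of at most $|\mathcal S|$ distinct sets with the values $x_S$ (all other $x_S$ are $0$). The constant hidden in the last $O(\cdot)$ depends only on the constant in the $O(n)$ bound for evaluating $c$. Here $x$ is basic if, after adding slack variables $s=\sum_S x_S\mathbf 1_S-\mathbf 1$, the columns of the nonzero variables among $(x,s)$ are linearly independent. -/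

import Mathlib

/-! ### The column-based covering linear program -/

/-- A family of subsets of `[n]` together with a cost in `(0,1]` for each of its members. -/
structure CoverInstance (n : ℕ) where
  family : Finset (Finset (Fin n))
  cost : {S // S ∈ family} → ℝ
  cost_pos : ∀ S, 0 < cost S
  cost_le_one : ∀ S, cost S ≤ 1

namespace CoverInstance

variable {n : ℕ} (I : CoverInstance n)

/-- The index set of the columns: the members of the family. -/
abbrev Col : Type := {S // S ∈ I.family}

/-- The characteristic vector of a member of the family. -/
noncomputable def charVec (S : I.Col) : Fin n → ℝ := fun i => if i ∈ S.1 then 1 else 0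

/-- The left-hand side `∑_S x_S 1_S` of the covering constraints. -/
noncomputable def coverage (x : I.Col → ℝ) : Fin n → ℝ := ∑ S, x S • I.charVec S

/-- Feasibility: `∑_S x_S 1_S ≥ 1` and `x ≥ 0`. -/
def IsFeasible (x : I.Col → ℝ) : Prop :=
  (∀ i, 1 ≤ I.coverage x i) ∧ ∀ S, 0 ≤ x S

/-- The objective value `cᵀ x`. -/
noncomputable def objective (x : I.Col → ℝ) : ℝ := ∑ S, I.cost S * x S

/-- The optimum value `OPT_f` of the linear program. -/
noncomputable def optF : ℝ := sInf (I.objective '' {x | I.IsFeasible x})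

/-- A basic (feasible) solution: in the equality form `∑_S x_S 1_S - s = 1`, `x, s ≥ 0` with one
slack variable per element, the columns of the nonzero variables are linearly independent. -/
def IsBasicSolution (x : I.Col → ℝ) : Prop :=
  I.IsFeasible x ∧
    LinearIndependent ℝ
      (Sum.elim (fun S : {S : I.Col // x S ≠ 0} => I.charVec S.1)
        (fun i : {i : Fin n // I.coverage x i - 1 ≠ 0} => -(Pi.single i.1 (1 : ℝ) : Fin n → ℝ)))

/-- `sep` solves the dual separation problem: for rational prices `y ≥ 0` and rational
`0 < ε < 1` it returns a member of the family that is a `(1 - ε)`-approximation to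
`max {(1 / c(S)) ∑_{i ∈ S} y_i | S}`. -/
def IsDualSeparation (sep : (Fin n → ℚ) → ℚ → I.Col) : Prop :=
  ∀ (y : Fin n → ℚ) (ε : ℚ), (∀ i, 0 ≤ y i) → 0 < ε → ε < 1 → ∀ S : I.Col,
    (1 - (ε : ℝ)) * ((∑ i ∈ S.1, (y i : ℝ)) / I.cost S) ≤
      (∑ i ∈ (sep y ε).1, (y i : ℝ)) / I.cost (sep y ε)

end CoverInstance

/-! ### Unit-cost random access machine with a separation and a cost subroutine

Programs are structured programs over finitely many arrays (named by numerals) of natural numbers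
and of real numbers, with unrestricted indirect addressing.  Every arithmetic operation, memory
access, comparison and assignment takes one time unit.  There is no rounding from real numbers to
natural numbers. -/

namespace RAM

/-- A memory content: `nat a k` and `real a k` are the `k`-th cells of the `a`-th arrays. -/
structure State where
  nat : ℕ → ℕ → ℕ
  real : ℕ → ℕ → ℝ

/-- Expressions for natural numbers (`sub` is truncated). -/
inductive NExpr where
  | const (k : ℕ)
  | get (a : ℕ) (idx : NExpr)
  | add (e f : NExpr)
  | sub (e f : NExpr)
  | mul (e f : NExpr)

def NExpr.eval (s : State) : NExpr → ℕ
  | .const k => k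
  | .get a idx => s.nat a (idx.eval s)
  | .add e f => e.eval s + f.eval s
  | .sub e f => e.eval s - f.eval s
  | .mul e f => e.eval s * f.eval s

/-- Number of operations needed to evaluate an expression. -/
def NExpr.time : NExpr → ℕ
  | .const _ => 1
  | .get _ idx => idx.time + 1
  | .add e f => e.time + f.time + 1
  | .sub e f => e.time + f.time + 1
  | .mul e f => e.time + f.time + 1

/-- Expressions for real numbers (division by zero returns zero). -/
inductive RExpr where
  | ofNat (e : NExpr)
  | get (a : ℕ) (idx : NExpr)
  | add (e f : RExpr)
  | sub (e f : RExpr)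
  | mul (e f : RExpr)
  | div (e f : RExpr)

noncomputable def RExpr.eval (s : State) : RExpr → ℝ
  | .ofNat e => (e.eval s : ℝ)
  | .get a idx => s.real a (idx.eval s)
  | .add e f => e.eval s + f.eval s
  | .sub e f => e.eval s - f.eval s
  | .mul e f => e.eval s * f.eval s
  | .div e f => e.eval s / f.eval s

def RExpr.time : RExpr → ℕ
  | .ofNat e => e.time + 1
  | .get _ idx => idx.time + 1
  | .add e f => e.time + f.time + 1
  | .sub e f => e.time + f.time + 1
  | .mul e f => e.time + f.time + 1
  | .div e f => e.time + f.time + 1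

/-- Tests. -/
inductive BExpr where
  | natLt (e f : NExpr)
  | natEq (e f : NExpr)
  | realLt (e f : RExpr)
  | realEq (e f : RExpr)
  | not (b : BExpr)
  | and (b c : BExpr)

def BExpr.Holds (s : State) : BExpr → Prop
  | .natLt e f => e.eval s < f.eval s
  | .natEq e f => e.eval s = f.eval s
  | .realLt e f => e.eval s < f.eval s
  | .realEq e f => e.eval s = f.eval s
  | .not b => ¬ b.Holds s
  | .and b c => b.Holds s ∧ c.Holds s

def BExpr.time : BExpr → ℕ
  | .natLt e f => e.time + f.time + 1
  | .natEq e f => e.time + f.time + 1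
  | .realLt e f => e.time + f.time + 1
  | .realEq e f => e.time + f.time + 1
  | .not b => b.time + 1
  | .and b c => b.time + c.time + 1

/-- Programs. `separate ya yo eps sa so` calls the separation subroutine on the prices stored in
the real array `ya` from position `yo` on, with accuracy `eps`, and stores the 0/1 vector of the
set it returns in the natural number array `sa` from position `so` on.
`evalCost sa so ra ro` stores the cost of the set given by its 0/1 vector in the natural number
array `sa` from position `so` on in cell `ro` of the real array `ra`. -/
inductive Program where
  | skip
  | setNat (a : ℕ) (idx e : NExpr)
  | setReal (a : ℕ) (idx : NExpr) (e : RExpr)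
  | seq (p q : Program)
  | ite (b : BExpr) (p q : Program)
  | while (b : BExpr) (p : Program)
  | separate (ya : ℕ) (yo : NExpr) (eps : RExpr) (sa : ℕ) (so : NExpr)
  | evalCost (sa : ℕ) (so : NExpr) (ra : ℕ) (ro : NExpr)

def State.putNat (s : State) (a k v : ℕ) : State :=
  { s with nat := Function.update s.nat a (Function.update (s.nat a) k v) }

noncomputable def State.putReal (s : State) (a k : ℕ) (v : ℝ) : State :=
  { s with real := Function.update s.real a (Function.update (s.real a) k v) }

/-- The 0/1 vector of `S` is stored in array `a` from position `o` on. -/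
def State.HoldsSet {n : ℕ} (s : State) (a o : ℕ) (S : Finset (Fin n)) : Prop :=
  ∀ i : Fin n, s.nat a (o + i) = if i ∈ S then 1 else 0

/-- Store the 0/1 vector of `S` in array `a` from position `o` on. -/
def State.putSet {n : ℕ} (s : State) (a o : ℕ) (S : Finset (Fin n)) : State :=
  { s with
    nat := Function.update s.nat a (fun k =>
      if h : o ≤ k ∧ k < o + n then
        (if (⟨k - o, by omega⟩ : Fin n) ∈ S then 1 else 0)
      else s.nat a k) }

/-- The two subroutines that come with an instance, and their running times. -/
structure Subroutines {n : ℕ} (I : CoverInstance n) where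
  sep : (Fin n → ℚ) → ℚ → I.Col
  sepTime : ℚ → ℝ
  costTime : ℝ

/-- `Run O p s t s₁`: program `p`, started with memory `s`, halts after time `t` with memory `s₁`.
The separation subroutine may be called only on nonnegative rational prices and a rational
accuracy in `(0,1)`, the cost subroutine only on members of the family; a subroutine call takes
the time of the subroutine plus `n + 1` units for handing over the data. -/
inductive Run {n : ℕ} {I : CoverInstance n} (O : Subroutines I) :
    Program → State → ℝ → State → Prop where
  | skip (s : State) : Run O .skip s 1 s
  | setNat (a : ℕ) (idx e : NExpr) (s : State) :
      Run O (.setNat a idx e) s (idx.time + e.time + 1) (s.putNat a (idx.eval s) (e.eval s))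
  | setReal (a : ℕ) (idx : NExpr) (e : RExpr) (s : State) :
      Run O (.setReal a idx e) s (idx.time + e.time + 1) (s.putReal a (idx.eval s) (e.eval s))
  | seq {p q : Program} {s s₁ s₂ : State} {t₁ t₂ : ℝ} :
      Run O p s t₁ s₁ → Run O q s₁ t₂ s₂ → Run O (.seq p q) s (t₁ + t₂) s₂
  | ite_true {b : BExpr} {p q : Program} {s s₁ : State} {t : ℝ} :
      b.Holds s → Run O p s t s₁ → Run O (.ite b p q) s (b.time + 1 + t) s₁
  | ite_false {b : BExpr} {p q : Program} {s s₁ : State} {t : ℝ} :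
      ¬ b.Holds s → Run O q s t s₁ → Run O (.ite b p q) s (b.time + 1 + t) s₁
  | while_false {b : BExpr} {p : Program} {s : State} :
      ¬ b.Holds s → Run O (.while b p) s (b.time + 1) s
  | while_true {b : BExpr} {p : Program} {s s₁ s₂ : State} {t₁ t₂ : ℝ} :
      b.Holds s → Run O p s t₁ s₁ → Run O (.while b p) s₁ t₂ s₂ →
      Run O (.while b p) s (b.time + 1 + t₁ + t₂) s₂
  | separate {ya : ℕ} {yo : NExpr} {eps : RExpr} {sa : ℕ} {so : NExpr} {s : State}
      (y : Fin n → ℚ) (ε : ℚ) :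
      (∀ i : Fin n, s.real ya (yo.eval s + i) = (y i : ℝ)) → (∀ i, 0 ≤ y i) →
      eps.eval s = (ε : ℝ) → 0 < ε → ε < 1 →
      Run O (.separate ya yo eps sa so) s
        (yo.time + eps.time + so.time + (n + 1) + O.sepTime ε)
        (s.putSet sa (so.eval s) (O.sep y ε).1)
  | evalCost {sa : ℕ} {so : NExpr} {ra : ℕ} {ro : NExpr} {s : State} (S : I.Col) :
      s.HoldsSet sa (so.eval s) S.1 →
      Run O (.evalCost sa so ra ro) s
        (so.time + ro.time + (n + 1) + O.costTime)
        (s.putReal ra (ro.eval s) (I.cost S))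

/-- The initial memory: the input is `n` and `δ`, everything else is zero. -/
noncomputable def initState (n : ℕ) (δ : ℝ) : State :=
  State.putReal (State.putNat ⟨fun _ _ => 0, fun _ _ => 0⟩ 0 0 n) 0 0 δ

/-- The memory holds the vector `x` as a sparse list: cell 0 of natural number array 0 holds the
number `m` of entries, natural number array 1 holds the 0/1 vectors of `m` distinct members of the
family one after the other, real array 0 holds the values of `x` there, and `x` vanishes on all
other members. -/
def Outputs {n : ℕ} (I : CoverInstance n) (s : State) (x : I.Col → ℝ) : Prop :=
  ∃ S : Fin (s.nat 0 0) → I.Col, Function.Injective S ∧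
    (∀ j, s.HoldsSet 1 (j.1 * n) (S j).1) ∧
    (∀ j, s.real 0 j.1 = x (S j)) ∧
    ∀ S₁, S₁ ∉ Set.range S → x S₁ = 0

end RAM

/-!
The algorithm is a multiplicative weight method followed, set by set, by simplex pivots.

Put `m = ⌈8 n / δ⌉`, `ε = 1 / m` and `N = m² L`, where `L` is the least number with `m ≤ 2 ^ L`.
An element that has been covered `k` times has the price `(1 - ε) ^ k`, and the price `0` once
`k ≥ N`; elements with `k < N` are called active. In each round the separation subroutine, called
with accuracy `ε`, returns a set `S` that is nearly as dense as an optimal solution of the linear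
program (`CoverInstance.IsDualSeparation.mul_sum_le`). While more than `n / m` elements are active,
`S` is bought with weight `1`, which multiplies the sum of the prices by at most
`exp (- ε (1 - ε) c(S) / OPT)`. As each active element contributes at least `(1 - ε) ^ N`, the cost
paid in this phase is at most `OPT N (1 + 4 ε)` up to the last set (`cost_le_of_active`). When at
most `n / m` elements are active, `S` is bought with weight `N`, so that each round deactivates an
element at cost at most `N`. Stopping the first phase at `n / m` active elements, and not at none,
is what gives `ln (n / δ)` rather than `ln n` in the running time. `CostBounds` collects both
bounds; after division by `N` they give `OPT + 6 ε n ≤ OPT + δ`, as `OPT ≤ n`. Each round increases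
`∑ i, min (k i) N`, so there are at most `n N` rounds.

All the time the memory holds a feasible basis of the equality form of the linear program, with
right-hand side `k`, and the inverse of the basis matrix (`Tableau`). Initially the basis consists
of the slack variables. A variable enters with its weight; the solution is then moved along the
kernel vector of the `n + 1` columns, in the direction in which the cost does not increase, until a
variable becomes zero and leaves (`halts_enter`). This takes `O(n²)` steps. After the last round the
slack variable of each element `i` enters with weight `k i - N`, and the right-hand side becomes
`(N, …, N)`. All nonzero variables then belong to a basis (`Tableau.isBasicSolution`).
-/

/-! ### The covering linear program -/

namespace CoverInstance

open Finset

variable {n : ℕ} (I : CoverInstance n)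

/-- The column of a variable of the linear program in equality form: the variables are the members
of the family and one slack variable per element. -/
noncomputable def colVec : I.Col ⊕ Fin n → Fin n → ℝ :=
  Sum.elim I.charVec fun i => -Pi.single i 1

/-- The cost of a variable of the linear program in equality form. -/
noncomputable def colCost : I.Col ⊕ Fin n → ℝ :=
  Sum.elim I.cost fun _ => 0

theorem colCost_nonneg (v : I.Col ⊕ Fin n) : 0 ≤ I.colCost v := by
  cases v with
  | inl S => exact (I.cost_pos S).le
  | inr i => exact le_rfl

theorem coverage_apply (x : I.Col → ℝ) (i : Fin n) :
    I.coverage x i = ∑ S, x S * I.charVec S i := by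
  simp [coverage, Finset.sum_apply]

theorem sum_mul_charVec (y : Fin n → ℝ) (S : I.Col) :
    ∑ i, y i * I.charVec S i = ∑ i ∈ S.1, y i := by
  simp [charVec, Finset.sum_ite_mem]

variable {I}

theorem IsFeasible.objective_nonneg {z : I.Col → ℝ} (hz : I.IsFeasible z) : 0 ≤ I.objective z :=
  sum_nonneg fun S _ => mul_nonneg (I.cost_pos S).le (hz.2 S)

theorem le_optF {a : ℝ} (hfeas : ∃ z, I.IsFeasible z)
    (h : ∀ z, I.IsFeasible z → a ≤ I.objective z) :
    a ≤ I.optF := by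
  obtain ⟨z, hz⟩ := hfeas
  refine le_csInf ⟨_, z, hz, rfl⟩ ?_
  rintro _ ⟨z, hz, rfl⟩
  exact h z hz

theorem optF_le {z : I.Col → ℝ} (hz : I.IsFeasible z) : I.optF ≤ I.objective z := by
  refine csInf_le ⟨0, ?_⟩ ⟨z, hz, rfl⟩
  rintro _ ⟨z, hz, rfl⟩
  exact hz.objective_nonneg

theorem optF_nonneg (hfeas : ∃ z, I.IsFeasible z) : 0 ≤ I.optF :=
  le_optF hfeas fun _ hz => hz.objective_nonneg

/-- Covering every element by a set of its own costs at most `n`. -/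
theorem optF_le_card (hfeas : ∃ z, I.IsFeasible z) : I.optF ≤ n := by
  obtain ⟨z, hz⟩ := hfeas
  have hex : ∀ i : Fin n, ∃ S : I.Col, i ∈ S.1 := by
    intro i
    by_contra! h
    have := hz.1 i
    rw [coverage_apply, sum_eq_zero fun S _ => by simp [charVec, h S]] at this
    linarith
  choose S hS using hex
  have hx : I.IsFeasible fun S' => ∑ i, if S i = S' then 1 else 0 := by
    refine ⟨fun i => ?_, fun S' => sum_nonneg fun i _ => by split_ifs <;> norm_num⟩
    rw [coverage_apply]
    have h0 : ∀ S', 0 ≤ (∑ i, if S i = S' then (1 : ℝ) else 0) * I.charVec S' i := fun S' =>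
      mul_nonneg (sum_nonneg fun i _ => by split_ifs <;> norm_num)
        (by unfold charVec; split_ifs <;> norm_num)
    refine le_trans ?_ (single_le_sum (fun S' _ => h0 S') (mem_univ (S i)))
    have h1 : (1 : ℝ) ≤ ∑ i', if S i' = S i then (1 : ℝ) else 0 :=
      le_trans (by simp) (single_le_sum (f := fun i' => if S i' = S i then (1 : ℝ) else 0)
        (fun i' _ => by split_ifs <;> norm_num) (mem_univ i))
    simpa [charVec, hS i] using h1
  refine (optF_le hx).trans ?_
  simp only [objective, mul_sum]
  rw [sum_comm]
  calc ∑ i, ∑ S', I.cost S' * (if S i = S' then (1 : ℝ) else 0) = ∑ i, I.cost (S i) := by simp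
    _ ≤ ∑ _i : Fin n, (1 : ℝ) := sum_le_sum fun i _ => I.cost_le_one _
    _ = n := by simp

/-- The set returned by the separation subroutine is nearly as dense, with respect to the prices,
as an optimal solution of the linear program. -/
theorem IsDualSeparation.mul_sum_le {sep : (Fin n → ℚ) → ℚ → I.Col} (hsep : I.IsDualSeparation sep)
    (hfeas : ∃ z, I.IsFeasible z) {y : Fin n → ℚ} {ε : ℚ} (hy : ∀ i, 0 ≤ y i) (h0 : 0 < ε)
    (h1 : ε < 1) :
    (1 - (ε : ℝ)) * I.cost (sep y ε) * ∑ i, (y i : ℝ) ≤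
      I.optF * ∑ i ∈ (sep y ε).1, (y i : ℝ) := by
  obtain ⟨S₀, hS₀⟩ : ∃ S₀, sep y ε = S₀ := ⟨_, rfl⟩
  have hc := I.cost_pos S₀
  have hy' : ∀ i, (0 : ℝ) ≤ y i := fun i => by exact_mod_cast hy i
  have hs := hsep y ε hy h0 h1
  rw [hS₀] at hs ⊢
  obtain ⟨P, hP⟩ : ∃ P, ∑ i ∈ S₀.1, (y i : ℝ) = P := ⟨_, rfl⟩
  have hP0 : 0 ≤ P := hP ▸ sum_nonneg fun i _ => hy' i
  rw [hP] at hs ⊢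
  have key : ∀ z, I.IsFeasible z →
      (1 - (ε : ℝ)) * I.cost S₀ * ∑ i, (y i : ℝ) ≤ I.objective z * P := by
    intro z hz
    have hε : (0 : ℝ) < 1 - ε := by
      have : (ε : ℝ) < 1 := by exact_mod_cast h1
      linarith
    calc (1 - (ε : ℝ)) * I.cost S₀ * ∑ i, (y i : ℝ)
        ≤ (1 - (ε : ℝ)) * I.cost S₀ * ∑ i, (y i : ℝ) * I.coverage z i := by
          refine mul_le_mul_of_nonneg_left (sum_le_sum fun i _ => ?_) (by positivity)
          exact le_mul_of_one_le_right (hy' i) (hz.1 i)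
      _ = ∑ S, z S * ((1 - (ε : ℝ)) * I.cost S₀ * ∑ i ∈ S.1, (y i : ℝ)) := by
          simp only [coverage_apply, mul_sum, ← sum_mul_charVec]
          rw [sum_comm]
          refine sum_congr rfl fun S _ => sum_congr rfl fun i _ => by ring
      _ ≤ ∑ S, z S * (I.cost S * P) := by
          refine sum_le_sum fun S _ => mul_le_mul_of_nonneg_left ?_ (hz.2 S)
          have h := hs S
          have hcS := I.cost_pos S
          rw [← mul_div_assoc, div_le_div_iff₀ hcS hc] at h
          linarith
      _ = I.objective z * P := by
          simp only [objective, sum_mul]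
          exact sum_congr rfl fun S _ => by ring
  rcases hP0.eq_or_lt with h | h
  · obtain ⟨z, hz⟩ := hfeas
    have := key z hz
    rw [← h] at this ⊢
    simpa using this
  · rw [← div_le_iff₀ h]
    exact le_optF hfeas fun z hz => by rw [div_le_iff₀ h]; exact key z hz

theorem IsDualSeparation.optF_pos {sep : (Fin n → ℚ) → ℚ → I.Col} (hsep : I.IsDualSeparation sep)
    (hfeas : ∃ z, I.IsFeasible z) (hn : 0 < n) : 0 < I.optF := by
  refine (optF_nonneg hfeas).lt_of_ne' fun h => ?_
  have := hsep.mul_sum_le hfeas (y := fun _ => 1) (ε := 1 / 2) (by simp) (by norm_num)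
    (by norm_num)
  rw [h, zero_mul] at this
  have hn' : (0 : ℝ) < n := by exact_mod_cast hn
  have h2 : 0 < (1 - ((1 / 2 : ℚ) : ℝ)) * I.cost (sep (fun _ => 1) (1 / 2)) *
      ∑ _i : Fin n, ((1 : ℚ) : ℝ) :=
    mul_pos (mul_pos (by norm_num) (I.cost_pos _)) (by simpa using hn')
  linarith

end CoverInstance

namespace RAM

/-! ### Reasoning about programs -/

instance (k : ℕ) : OfNat NExpr k := ⟨.const k⟩
instance : Add NExpr := ⟨.add⟩
instance : Mul NExpr := ⟨.mul⟩
instance : Sub NExpr := ⟨.sub⟩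
instance (k : ℕ) : OfNat RExpr k := ⟨.ofNat (.const k)⟩
instance : Add RExpr := ⟨.add⟩
instance : Mul RExpr := ⟨.mul⟩
instance : Sub RExpr := ⟨.sub⟩
instance : Div RExpr := ⟨.div⟩

section Eval

variable (s : State)

@[simp] theorem NExpr.eval_lit (k : ℕ) : (ofNat(k) : NExpr).eval s = ofNat(k) := rfl
@[simp] theorem NExpr.eval_add (e f : NExpr) : (e + f).eval s = e.eval s + f.eval s := rfl
@[simp] theorem NExpr.eval_mul (e f : NExpr) : (e * f).eval s = e.eval s * f.eval s := rfl
@[simp] theorem NExpr.eval_sub (e f : NExpr) : (e - f).eval s = e.eval s - f.eval s := rfl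
@[simp] theorem NExpr.eval_get (a : ℕ) (e : NExpr) :
    (NExpr.get a e).eval s = s.nat a (e.eval s) := rfl
@[simp] theorem RExpr.eval_lit (k : ℕ) : (ofNat(k) : RExpr).eval s = ((ofNat(k) : ℕ) : ℝ) := rfl
@[simp] theorem RExpr.eval_add (e f : RExpr) : (e + f).eval s = e.eval s + f.eval s := rfl
@[simp] theorem RExpr.eval_mul (e f : RExpr) : (e * f).eval s = e.eval s * f.eval s := rfl
@[simp] theorem RExpr.eval_sub (e f : RExpr) : (e - f).eval s = e.eval s - f.eval s := rfl
@[simp] theorem RExpr.eval_div (e f : RExpr) : (e / f).eval s = e.eval s / f.eval s := rfl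
@[simp] theorem RExpr.eval_get (a : ℕ) (e : NExpr) :
    (RExpr.get a e).eval s = s.real a (e.eval s) := rfl
@[simp] theorem RExpr.eval_ofNat (e : NExpr) : (RExpr.ofNat e).eval s = (e.eval s : ℝ) := rfl
@[simp] theorem BExpr.holds_natLt (e f : NExpr) :
    (BExpr.natLt e f).Holds s ↔ e.eval s < f.eval s := Iff.rfl
@[simp] theorem BExpr.holds_realLt (e f : RExpr) :
    (BExpr.realLt e f).Holds s ↔ e.eval s < f.eval s := Iff.rfl
@[simp] theorem BExpr.holds_not (b : BExpr) : (BExpr.not b).Holds s ↔ ¬ b.Holds s := Iff.rfl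
@[simp] theorem BExpr.holds_and (b c : BExpr) :
    (BExpr.and b c).Holds s ↔ b.Holds s ∧ c.Holds s := Iff.rfl

end Eval

namespace State

variable (s : State) (a k b l : ℕ)

@[simp] theorem putNat_nat (v : ℕ) :
    (s.putNat a k v).nat b l = if b = a ∧ l = k then v else s.nat b l := by
  by_cases h : b = a
  · subst h
    by_cases h' : l = k <;> simp [putNat, h']
  · simp [putNat, h]

@[simp] theorem putNat_real (v : ℕ) : (s.putNat a k v).real = s.real := rfl

@[simp] theorem putReal_real (v : ℝ) :
    (s.putReal a k v).real b l = if b = a ∧ l = k then v else s.real b l := by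
  by_cases h : b = a
  · subst h
    by_cases h' : l = k <;> simp [putReal, h']
  · simp [putReal, h]

@[simp] theorem putReal_nat (v : ℝ) : (s.putReal a k v).nat = s.nat := rfl

theorem putNat_nat_of_ne (v : ℕ) (h : b ≠ a) : (s.putNat a k v).nat b = s.nat b := by
  simp [putNat, h]

theorem putReal_real_of_ne (v : ℝ) (h : b ≠ a) : (s.putReal a k v).real b = s.real b := by
  simp [putReal, h]

theorem putSet_nat_of_ne {n : ℕ} (S : Finset (Fin n)) (h : b ≠ a) :
    (s.putSet a k S).nat b = s.nat b := by
  simp [putSet, h]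

theorem putSet_nat_of_lt {n : ℕ} (S : Finset (Fin n)) (h : l < k) :
    (s.putSet a k S).nat a l = s.nat a l := by
  have : ¬ (k ≤ l ∧ l < k + n) := by omega
  simp [putSet, this]

theorem holdsSet_putSet {n : ℕ} (S : Finset (Fin n)) : (s.putSet a k S).HoldsSet a k S := by
  intro i
  have : k ≤ k + (i : ℕ) ∧ k + (i : ℕ) < k + n := by omega
  simp [putSet]

end State

/-- Whether a program may write to the natural number array `a`. -/
def Program.writesNat (a : ℕ) : Program → Bool
  | .setNat b _ _ => a == b
  | .seq p q => p.writesNat a || q.writesNat a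
  | .ite _ p q => p.writesNat a || q.writesNat a
  | .while _ p => p.writesNat a
  | .separate _ _ _ b _ => a == b
  | _ => false

/-- Whether a program may write to the real array `a`. -/
def Program.writesReal (a : ℕ) : Program → Bool
  | .setReal b _ _ => a == b
  | .seq p q => p.writesReal a || q.writesReal a
  | .ite _ p q => p.writesReal a || q.writesReal a
  | .while _ p => p.writesReal a
  | .evalCost _ _ b _ => a == b
  | _ => false

/-- The arrays that `p` does not write to have the same content in `s` and in `s₁`. -/
structure Frame (p : Program) (s s₁ : State) : Prop where
  nat : ∀ a, p.writesNat a = false → s₁.nat a = s.nat a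
  real : ∀ a, p.writesReal a = false → s₁.real a = s.real a

theorem Frame.refl (p : Program) (s : State) : Frame p s s := ⟨fun _ _ => rfl, fun _ _ => rfl⟩

theorem Frame.trans {p q r : Program} {s s₁ s₂ : State} (h : Frame q s s₁) (h' : Frame r s₁ s₂)
    (hn : ∀ a, p.writesNat a = false → q.writesNat a = false ∧ r.writesNat a = false)
    (hr : ∀ a, p.writesReal a = false → q.writesReal a = false ∧ r.writesReal a = false) :
    Frame p s s₂ :=
  ⟨fun a ha => (h'.nat a (hn a ha).2).trans (h.nat a (hn a ha).1),
    fun a ha => (h'.real a (hr a ha).2).trans (h.real a (hr a ha).1)⟩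

variable {n : ℕ} {I : CoverInstance n} {O : Subroutines I}

theorem Run.frame {p : Program} {s s₁ : State} {t : ℝ} (h : Run O p s t s₁) : Frame p s s₁ := by
  induction h with
  | skip s => exact .refl _ _
  | setNat a idx e s =>
    exact ⟨fun b hb => s.putNat_nat_of_ne _ _ _ _ (by simpa [Program.writesNat] using hb),
      fun _ _ => rfl⟩
  | setReal a idx e s =>
    exact ⟨fun _ _ => rfl,
      fun b hb => s.putReal_real_of_ne _ _ _ _ (by simpa [Program.writesReal] using hb)⟩
  | seq _ _ h h' =>
    exact h.trans h' (by simp [Program.writesNat]) (by simp [Program.writesReal])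
  | ite_true _ _ h =>
    exact h.trans (.refl .skip _) (by simp +contextual [Program.writesNat])
      (by simp +contextual [Program.writesReal])
  | ite_false _ _ h =>
    exact h.trans (.refl .skip _) (by simp +contextual [Program.writesNat])
      (by simp +contextual [Program.writesReal])
  | while_false _ => exact .refl _ _
  | while_true _ _ _ h h' =>
    exact h.trans h' (by simp [Program.writesNat]) (by simp [Program.writesReal])
  | separate y ε =>
    exact ⟨fun b hb => State.putSet_nat_of_ne _ _ _ _ _ (by simpa [Program.writesNat] using hb),
      fun _ _ => rfl⟩
  | evalCost S =>
    exact ⟨fun _ _ => rfl,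
      fun b hb => State.putReal_real_of_ne _ _ _ _ _ (by simpa [Program.writesReal] using hb)⟩

/-- Started in `s`, the program `p` halts within time `t` in a memory that satisfies `Q`.
The constants in the time bounds are rounded up generously throughout. -/
def Halts (O : Subroutines I) (p : Program) (s : State) (t : ℝ) (Q : State → Prop) : Prop :=
  ∃ t₁ s₁, Run O p s t₁ s₁ ∧ t₁ ≤ t ∧ Q s₁

namespace Halts

variable {p q : Program} {s : State} {t t₁ t₂ : ℝ} {Q R : State → Prop}

theorem mono (h : Halts O p s t₁ Q) (ht : t₁ ≤ t) (hQ : ∀ s₁, Frame p s s₁ → Q s₁ → R s₁) :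
    Halts O p s t R := by
  obtain ⟨t', s', hr, ht', hq⟩ := h
  exact ⟨t', s', hr, ht'.trans ht, hQ _ hr.frame hq⟩

theorem time_le (h : Halts O p s t₁ Q) (ht : t₁ ≤ t) : Halts O p s t Q :=
  h.mono ht fun _ _ => id

theorem seq (h : Halts O p s t₁ Q) (h' : ∀ s₁, Frame p s s₁ → Q s₁ → Halts O q s₁ t₂ R) :
    Halts O (.seq p q) s (t₁ + t₂) R := by
  obtain ⟨t', s', hr, ht', hq⟩ := h
  obtain ⟨t'', s'', hr', ht'', hq'⟩ := h' s' hr.frame hq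
  exact ⟨_, _, hr.seq hr', add_le_add ht' ht'', hq'⟩

theorem seq_le (Q : State → Prop) (h : Halts O p s t₁ Q)
    (h' : ∀ s₁, Frame p s s₁ → Q s₁ → Halts O q s₁ t₂ R) (ht : t₁ + t₂ ≤ t) :
    Halts O (.seq p q) s t R :=
  (h.seq h').time_le ht

theorem ite {b : BExpr} (h : b.Holds s → Halts O p s t Q) (h' : ¬ b.Holds s → Halts O q s t Q) :
    Halts O (.ite b p q) s (b.time + 1 + t) Q := by
  by_cases hb : b.Holds s
  · obtain ⟨t', s', hr, ht', hq⟩ := h hb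
    exact ⟨_, _, hr.ite_true hb, by linarith, hq⟩
  · obtain ⟨t', s', hr, ht', hq⟩ := h' hb
    exact ⟨_, _, hr.ite_false hb, by linarith, hq⟩

/-- The rule for loops: the index `k` of the invariant decreases in each round and therefore bounds
the number of rounds. -/
theorem whileLoop {b : BExpr} (Inv : ℕ → State → Prop) (ht : 0 ≤ t)
    (step : ∀ k s, Inv k s → b.Holds s → Halts O p s t fun s₁ => ∃ k₁ < k, Inv k₁ s₁)
    (k : ℕ) (s : State) (hs : Inv k s) :
    Halts O (.while b p) s (k * (b.time + 1 + t) + (b.time + 1))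
      fun s₁ => (∃ k₁ ≤ k, Inv k₁ s₁) ∧ ¬ b.Holds s₁ := by
  induction k using Nat.strong_induction_on generalizing s with
  | _ k ih =>
    have hb0 : (0 : ℝ) ≤ b.time := Nat.cast_nonneg _
    by_cases hb : b.Holds s
    · obtain ⟨t', s', hr, ht', k₁, hk, hi⟩ := step k s hs hb
      obtain ⟨t'', s'', hr', ht'', ⟨k₂, hk₂, hi₂⟩, hq⟩ := ih k₁ hk s' hi
      refine ⟨_, _, hr.while_true hb hr', ?_, ⟨k₂, by omega, hi₂⟩, hq⟩
      have : ((k₁ + 1 : ℕ) : ℝ) * (b.time + 1 + t) ≤ k * (b.time + 1 + t) := by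
        gcongr
        exact_mod_cast hk
      push_cast at this
      linarith
    · have : 0 ≤ (k : ℝ) * (b.time + 1 + t) := by positivity
      exact ⟨_, _, .while_false hb, by linarith, ⟨k, le_rfl, hs⟩, hb⟩

end Halts

/-! ### Straight-line programs -/

/-- Programs without loops and subroutine calls. -/
def Program.straight : Program → Bool
  | .skip => true
  | .setNat _ _ _ => true
  | .setReal _ _ _ => true
  | .seq p q => p.straight && q.straight
  | .ite _ p q => p.straight && q.straight
  | _ => false

/-- An upper bound for the running time of a straight-line program. -/
def Program.steps : Program → ℕ
  | .skip => 1
  | .setNat _ idx e => idx.time + e.time + 1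
  | .setReal _ idx e => idx.time + e.time + 1
  | .seq p q => p.steps + q.steps
  | .ite b p q => b.time + 1 + (p.steps + q.steps)
  | _ => 0

open Classical in
/-- The memory after the execution of a straight-line program. -/
noncomputable def Program.exec : Program → State → State
  | .setNat a idx e, s => s.putNat a (idx.eval s) (e.eval s)
  | .setReal a idx e, s => s.putReal a (idx.eval s) (e.eval s)
  | .seq p q, s => q.exec (p.exec s)
  | .ite b p q, s => if b.Holds s then p.exec s else q.exec s
  | _, s => s

/-- Straight-line programs halt in the memory given by `exec`. -/
theorem Program.run_exec {p : Program} (hp : p.straight = true) (s : State) :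
    ∃ t, Run O p s t (p.exec s) ∧ t ≤ p.steps := by
  induction p generalizing s with
  | skip => exact ⟨_, .skip s, by simp [steps]⟩
  | setNat a idx e => exact ⟨_, .setNat a idx e s, by simp [steps]⟩
  | setReal a idx e => exact ⟨_, .setReal a idx e s, by simp [steps]⟩
  | seq p q ihp ihq =>
    simp only [straight, Bool.and_eq_true] at hp
    obtain ⟨t, h, ht⟩ := ihp hp.1 s
    obtain ⟨t', h', ht'⟩ := ihq hp.2 (p.exec s)
    exact ⟨_, h.seq h', by simp only [steps]; push_cast; linarith⟩
  | ite b p q ihp ihq =>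
    simp only [straight, Bool.and_eq_true] at hp
    have hp0 : (0 : ℝ) ≤ p.steps := Nat.cast_nonneg _
    have hq0 : (0 : ℝ) ≤ q.steps := Nat.cast_nonneg _
    by_cases hb : b.Holds s
    · obtain ⟨t, h, ht⟩ := ihp hp.1 s
      refine ⟨_, by simpa [exec, hb] using h.ite_true hb, ?_⟩
      simp only [steps]; push_cast; linarith
    · obtain ⟨t, h, ht⟩ := ihq hp.2 s
      refine ⟨_, by simpa [exec, hb] using h.ite_false hb, ?_⟩
      simp only [steps]; push_cast; linarith
  | _ => simp [straight] at hp

theorem Halts.of_straight {p : Program} {s : State} {Q : State → Prop} {c : ℕ}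
    (hp : p.straight = true) (hc : p.steps ≤ c) (h : Q (p.exec s)) : Halts O p s c Q := by
  obtain ⟨t, hr, ht⟩ := p.run_exec (O := O) hp s
  exact ⟨t, _, hr, ht.trans (by exact_mod_cast hc), h⟩

/-! ### Counting loops -/

/-- Execute `body` for `i = 0, …, bound - 1`, where the counter `i` is cell `0` of the natural
number array `i`. -/
def forLoop (i : ℕ) (bound : NExpr) (body : Program) : Program :=
  .seq (.setNat i 0 0)
    (.while (.natLt (.get i 0) bound) (.seq body (.setNat i 0 (.get i 0 + 1))))

/-- The rule for counting loops: `Inv k` is to hold before round `k`, with the counter already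
updated. -/
theorem Halts.forLoop {i : ℕ} {bound : NExpr} {body : Program} {s : State} {N : ℕ} {t : ℝ}
    (Inv : ℕ → State → Prop) (ht : 0 ≤ t) (htime : bound.time ≤ 10)
    (hi : body.writesNat i = false)
    (hbound : ∀ s₁, Frame (RAM.forLoop i bound body) s s₁ → bound.eval s₁ = N)
    (init : Inv 0 (s.putNat i 0 0))
    (step : ∀ k < N, ∀ s₁, Frame (RAM.forLoop i bound body) s s₁ → s₁.nat i 0 = k → Inv k s₁ →
      Halts O body s₁ t fun s₂ => Inv (k + 1) (s₂.putNat i 0 (k + 1))) :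
    Halts O (RAM.forLoop i bound body) s ((N + 1) * (t + 30)) (Inv N) := by
  have key := Halts.whileLoop (O := O) (b := .natLt (.get i 0) bound)
    (p := .seq body (.setNat i 0 (.get i 0 + 1))) (t := t + 10)
    (fun k s₁ => Frame (RAM.forLoop i bound body) s s₁ ∧
      ∃ j, j + k = N ∧ s₁.nat i 0 = j ∧ Inv j s₁) (by linarith) ?_ N (s.putNat i 0 0) ?_
  · obtain ⟨t', s', hr, ht', ⟨k, -, hf, j, hj, hij, hinv⟩, hb⟩ := key
    refine ⟨_, s', (Run.setNat i 0 0 s).seq hr, ?_, ?_⟩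
    · have h1 : (0 : NExpr).time = 1 := rfl
      have h2 : (BExpr.natLt (.get i 0) bound).time = 2 + bound.time + 1 := rfl
      have h3 : (bound.time : ℝ) ≤ 10 := by exact_mod_cast htime
      rw [h2] at ht'
      rw [h1]
      push_cast at ht' ⊢
      nlinarith [(Nat.cast_nonneg N : (0 : ℝ) ≤ N)]
    · have : j = N := by
        have hN := hbound s' hf
        simp only [BExpr.holds_natLt, NExpr.eval_get, NExpr.eval_lit, hij, hN] at hb
        omega
      exact this ▸ hinv
  · rintro k s₁ ⟨hf, j, hj, hij, hinv⟩ hb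
    have hjN : j < N := by
      have hN := hbound s₁ hf
      simpa only [BExpr.holds_natLt, NExpr.eval_get, NExpr.eval_lit, hij, hN] using hb
    obtain ⟨t', s', hr, ht', hq⟩ := step j hjN s₁ hf hij hinv
    have hij' : s'.nat i 0 = j := by rw [hr.frame.nat i hi, hij]
    have hrun := hr.seq (Run.setNat i 0 (.get i 0 + 1) s')
    refine ⟨_, _, hrun, ?_, k - 1, by omega, ?_, j + 1, by omega, ?_, ?_⟩
    · have h1 : (0 : NExpr).time = 1 := rfl
      have h2 : (NExpr.get i 0 + 1).time = 4 := rfl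
      rw [h1, h2]
      push_cast
      linarith
    · refine hf.trans hrun.frame ?_ ?_ <;> simp [RAM.forLoop, Program.writesNat,
        Program.writesReal]
    · simp [hij']
    · simpa [hij'] using hq
  · refine ⟨⟨fun a ha => State.putNat_nat_of_ne _ _ _ _ _ ?_, fun _ _ => rfl⟩, 0, by simp, by simp,
      init⟩
    simp [RAM.forLoop, Program.writesNat] at ha
    exact ha.1

/-! ### Names for the arrays -/

/-!
The arrays `nX` hold natural numbers, the arrays `rX` hold real numbers. Scalars are kept in
cell `0` of an array of their own.

* Slots: `rVal`, `rCost`, `rDir`, `rInv` and `nSets` hold, for each of the slots `0, …, n`, the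
  value and the cost of its variable, its entry of the direction, its row of the inverse of the basis
  matrix, and its 0/1 vector; a slot has `n` cells in `rInv` and `nSets`. The column that enters is
  in `rCol`, and its weight in `nWeight`; `nLeave` is the slot of the leaving variable, `rRed` the
  reduced cost, `rSign` the sign of the direction and `rStep` the step length.
* Elements: `nCount` counts how often an element has been covered, `rPrice` holds the prices.
* Parameters: `nSize`, `nDenom`, `nLog` and `nScale` hold `n`, `m`, `L` and `N`.
* `nActive` is the number of active elements, and later the number of sets in the output.
* `nI`, `nJ` and `nE` are loop counters, `nPow`, `rAcc` and `rTmp` are auxiliary.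
* `nOut` and `rOut` receive the output, whose length finally replaces `n` in `nSize`; `rOut` starts
  with the input `δ` in cell `0`.
-/
notation "nSize" => (0 : ℕ)
notation "nOut" => (1 : ℕ)
notation "nDenom" => (2 : ℕ)
notation "nLog" => (3 : ℕ)
notation "nScale" => (4 : ℕ)
notation "nCount" => (5 : ℕ)
notation "nActive" => (6 : ℕ)
notation "nI" => (7 : ℕ)
notation "nJ" => (8 : ℕ)
notation "nWeight" => (9 : ℕ)
notation "nLeave" => (10 : ℕ)
notation "nE" => (11 : ℕ)
notation "nPow" => (12 : ℕ)
notation "nSets" => (13 : ℕ)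
notation "rOut" => (0 : ℕ)
notation "rPrice" => (1 : ℕ)
notation "rCost" => (2 : ℕ)
notation "rInv" => (3 : ℕ)
notation "rCol" => (4 : ℕ)
notation "rDir" => (5 : ℕ)
notation "rRed" => (6 : ℕ)
notation "rVal" => (7 : ℕ)
notation "rAcc" => (8 : ℕ)
notation "rSign" => (9 : ℕ)
notation "rStep" => (10 : ℕ)
notation "rTmp" => (11 : ℕ)

infixr:60 ";;" => Program.seq

/-- Cell `0` of a natural number array, used as a variable. -/
def NExpr.var (a : ℕ) : NExpr := .get a 0

/-- Cell `0` of a real array, used as a variable. -/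
def RExpr.var (a : ℕ) : RExpr := .get a 0

@[simp] theorem NExpr.eval_var (a : ℕ) (s : State) : (NExpr.var a).eval s = s.nat a 0 := rfl
@[simp] theorem RExpr.eval_var (a : ℕ) (s : State) : (RExpr.var a).eval s = s.real a 0 := rfl

theorem cell_inj {n j k j' k' : ℕ} (hk : k < n) (hk' : k' < n) :
    j * n + k = j' * n + k' ↔ j = j' ∧ k = k' := by
  constructor
  · intro h
    have h1 := congrArg (· / n) h
    have h2 := congrArg (· % n) h
    have hn : 0 < n := by omega
    simp only [Nat.mul_add_mod', Nat.mod_eq_of_lt hk, Nat.mod_eq_of_lt hk'] at h2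
    refine ⟨?_, h2⟩
    subst h2
    exact Nat.eq_of_mul_eq_mul_right hn (by omega)
  · rintro ⟨rfl, rfl⟩; rfl

/-! ### Entering a column into the basis -/

/-- Multiplies the inverse of the basis matrix by the entering column, and the result by the
costs. -/
def directionLoop : Program :=
  forLoop nJ (.var nSize + 1)
    (.setReal rAcc 0 0 ;;
      forLoop nI (.var nSize)
        (.setReal rAcc 0 (.var rAcc +
          .get rInv (.var nJ * .var nSize + .var nI) * .get rCol (.var nI))) ;;
      .setReal rDir (.var nJ) (.var rAcc) ;;
      .setReal rRed 0 (.var rRed + .get rCost (.var nJ) * .var rAcc))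

theorem halts_directionLoop {s : State} (hn : s.nat nSize 0 = n) (hr : s.real rRed 0 = 0)
    (u : ℕ → ℝ)
    (hu : ∀ j, u j = ∑ k ∈ Finset.range n, s.real rInv (j * n + k) * s.real rCol k) :
    Halts O directionLoop s ((n + 2) * ((n + 2) * 120)) fun s₁ =>
      (∀ j ≤ n, s₁.real rDir j = u j) ∧
      s₁.real rRed 0 = ∑ j ∈ Finset.range (n + 1), s.real rCost j * u j := by
  have hn0 : (0 : ℝ) ≤ n := Nat.cast_nonneg _
  refine (Halts.forLoop (N := n + 1) (t := (n + 1) * 50 + 60)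
    (fun J s₁ => (∀ j < J, s₁.real rDir j = u j) ∧
      s₁.real rRed 0 = ∑ j ∈ Finset.range J, s.real rCost j * u j)
    (by positivity) (by decide) (by rfl) ?_ ?_ ?_).mono ?_ ?_
  · intro s₁ hf
    simp [hf.nat nSize rfl, hn]
  · simp [hr]
  · rintro J - s₁ hf hJ ⟨hd, hred⟩
    refine Halts.seq_le (t₁ := (4 : ℕ)) (t₂ := (n + 1) * 50 + 50)
      (fun s₂ => s₂.real rAcc 0 = 0)
      (Halts.of_straight rfl (by decide) (by simp [Program.exec])) ?_ (by push_cast; linarith)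
    intro s₂ hf₂ hacc
    refine Halts.seq_le (t₁ := (n + 1) * ((20 : ℕ) + 30)) (t₂ := (30 : ℕ))
      (fun s₃ => s₃.real rAcc 0 = u J) ?_ ?_ (by push_cast; linarith)
    · rw [hu]
      refine Halts.forLoop
        (fun K s₃ => s₃.real rAcc 0 =
          ∑ k ∈ Finset.range K, s.real rInv (J * n + k) * s.real rCol k)
        (by positivity) (by decide) (by rfl) ?_ ?_ ?_
      · intro s₃ hf₃
        simp [hf₃.nat nSize rfl, hf₂.nat nSize rfl, hf.nat nSize rfl, hn]
      · simp [hacc]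
      · intro K hK s₃ hf₃ hK' hinv
        refine Halts.of_straight rfl (by decide) ?_
        simp [Program.exec, Finset.sum_range_succ, hinv, hK', hf₃.nat nSize rfl,
          hf₂.nat nSize rfl, hf.nat nSize rfl, hn, hf₃.nat nJ rfl, hf₂.nat nJ rfl, hJ,
          hf₃.real rInv rfl, hf₂.real rInv rfl, hf.real rInv rfl, hf₃.real rCol rfl,
          hf₂.real rCol rfl, hf.real rCol rfl]
    · intro s₃ hf₃ hacc₃
      refine Halts.of_straight rfl (by decide) ?_
      refine ⟨?_, ?_⟩
      · intro j hj
        simp only [Program.exec, State.putNat_real, State.putReal_real, NExpr.eval_var,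
          RExpr.eval_var, hacc₃, hf₃.nat nJ rfl, hf₂.nat nJ rfl, hJ,
          hf₃.real rDir rfl, hf₂.real rDir rfl]
        by_cases h : j = J
        · simp [h]
        · simpa [h] using hd j (by omega)
      · simp [Program.exec, Finset.sum_range_succ, hacc₃, hf₃.nat nJ rfl, hf₂.nat nJ rfl, hJ,
          hf₃.real rRed rfl, hf₂.real rRed rfl, hred, hf₃.real rCost rfl, hf₂.real rCost rfl,
          hf.real rCost rfl]
  · push_cast
    nlinarith
  · rintro s₁ - ⟨h1, h2⟩
    exact ⟨fun j hj => h1 j (by omega), h2⟩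

/-- Multiplies the direction by the sign, and finds the slot of the leaving variable by the minimum
ratio test. -/
def ratioLoop : Program :=
  forLoop nJ (.var nSize + 1)
    (.setReal rDir (.var nJ) (.var rSign * .get rDir (.var nJ)) ;;
      .ite (.and (.realLt (.get rDir (.var nJ)) 0)
          (.not (.and (.realLt (.get rDir (.var nLeave)) 0)
            (.not (.realLt (.get rVal (.var nJ) / (0 - .get rDir (.var nJ)))
              (.get rVal (.var nLeave) / (0 - .get rDir (.var nLeave))))))))
        (.setNat nLeave 0 (.var nJ)) .skip)

theorem halts_ratioLoop {s : State} (hn : s.nat nSize 0 = n) (hr : s.nat nLeave 0 = 0)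
    (d : ℕ → ℝ) (hd : ∀ j, d j = s.real rSign 0 * s.real rDir j) :
    Halts O ratioLoop s ((n + 2) * 130) fun s₁ =>
      (∀ j ≤ n, s₁.real rDir j = d j) ∧ s₁.nat nLeave 0 ≤ n ∧
      ∀ j ≤ n, d j < 0 → d (s₁.nat nLeave 0) < 0 ∧
        s.real rVal (s₁.nat nLeave 0) / (- d (s₁.nat nLeave 0)) ≤ s.real rVal j / (- d j) := by
  refine (Halts.forLoop (N := n + 1) (t := (100 : ℕ))
    (fun J s₁ => (∀ j, s₁.real rDir j = if j < J then d j else s.real rDir j) ∧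
      s₁.nat nLeave 0 ≤ J - 1 ∧
      ∀ j < J, d j < 0 → d (s₁.nat nLeave 0) < 0 ∧
        s.real rVal (s₁.nat nLeave 0) / (- d (s₁.nat nLeave 0)) ≤ s.real rVal j / (- d j))
    (by positivity) (by decide) (by rfl) ?_ ?_ ?_).mono ?_ ?_
  · intro s₁ hf
    simp [hf.nat nSize rfl, hn]
  · simp [hr]
  · rintro J - s₁ hf hJ ⟨hdir, hle, hmin⟩
    refine Halts.seq_le (t₁ := (10 : ℕ)) (t₂ := (90 : ℕ))
      (fun s₂ => ∀ j, s₂.real rDir j = if j < J + 1 then d j else s.real rDir j)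
      (Halts.of_straight rfl (by decide) ?_) ?_ (by norm_num)
    · intro j
      have h1 := hdir j
      have h2 := hdir J
      simp only [Program.exec, State.putReal_real, NExpr.eval_var, hJ, RExpr.eval_mul,
        RExpr.eval_var, RExpr.eval_get, hf.real rSign rfl, h1, h2, true_and]
      rcases lt_trichotomy j J with h | rfl | h
      · simp [h, h.ne, h.trans (Nat.lt_succ_self J)]
      · simp [hd]
      · simp [h.ne', not_lt.2 h.le, show ¬ j < J + 1 by omega]
    intro s₂ hf₂ hdir₂
    have hJ₂ : s₂.nat nJ 0 = J := by rw [hf₂.nat nJ rfl, hJ]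
    have hL₂ : s₂.nat nLeave = s₁.nat nLeave := hf₂.nat nLeave rfl
    have hx₂ : s₂.real rVal = s.real rVal := by rw [hf₂.real rVal rfl, hf.real rVal rfl]
    have hd₁ : s₂.real rDir J = d J := by simp [hdir₂]
    have hd₂ : s₂.real rDir (s₁.nat nLeave 0) = d (s₁.nat nLeave 0) := by
      rw [hdir₂, if_pos (by omega)]
    refine Halts.of_straight rfl (by decide) ?_
    rw [Program.exec]
    simp only [BExpr.holds_and, BExpr.holds_not, BExpr.holds_realLt, RExpr.eval_get,
      NExpr.eval_var, RExpr.eval_div, RExpr.eval_sub, RExpr.eval_lit, hJ₂, hL₂, hx₂, hd₁, hd₂,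
      Nat.cast_zero, zero_sub]
    split_ifs with hc
    · refine ⟨by simpa [Program.exec] using hdir₂, by simp [Program.exec, hJ₂], ?_⟩
      intro j hj hdj
      have hL : (((Program.setNat nLeave 0 (.var nJ)).exec s₂).putNat nJ 0 (J + 1)).nat
          nLeave 0 = J := by simp [Program.exec, hJ₂]
      obtain ⟨hc1, hc2⟩ := hc
      rw [hL]
      rcases Nat.lt_succ_iff_lt_or_eq.1 hj with h | rfl
      · obtain ⟨h1, h2⟩ := hmin j h hdj
        refine ⟨hc1, le_trans (le_of_lt ?_) h2⟩
        by_contra h3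
        exact hc2 ⟨h1, h3⟩
      · exact ⟨hdj, le_rfl⟩
    · refine ⟨by simpa [Program.exec] using hdir₂, by simp [Program.exec, hL₂]; omega, ?_⟩
      intro j hj hdj
      have hL : ((Program.skip.exec s₂).putNat nJ 0 (J + 1)).nat nLeave 0 =
          s₁.nat nLeave 0 := by simp [Program.exec, hL₂]
      rw [hL]
      rcases Nat.lt_succ_iff_lt_or_eq.1 hj with h | rfl
      · exact hmin j h hdj
      · by_contra h3
        exact hc ⟨hdj, fun h4 => h3 ⟨h4.1, not_lt.1 h4.2⟩⟩
  · push_cast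
    linarith
  · rintro s₁ - ⟨h1, h2, h3⟩
    refine ⟨fun j hj => by rw [h1, if_pos (by omega)], by omega, fun j hj => h3 j (by omega)⟩

/-- Moves the current solution along the direction, up to the point where the value of the leaving
column becomes zero. -/
def stepLoop : Program :=
  .setReal rStep 0 (.get rVal (.var nLeave) / (0 - .get rDir (.var nLeave))) ;;
    forLoop nJ (.var nSize + 1)
      (.setReal rVal (.var nJ) (.get rVal (.var nJ) + .var rStep * .get rDir (.var nJ)))

theorem halts_stepLoop {s : State} (hn : s.nat nSize 0 = n) (x : ℕ → ℝ)
    (hx : ∀ j, x j = s.real rVal j + s.real rVal (s.nat nLeave 0) /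
      (- s.real rDir (s.nat nLeave 0)) * s.real rDir j) :
    Halts O stepLoop s ((n + 2) * 80) fun s₁ => ∀ j ≤ n, s₁.real rVal j = x j := by
  refine Halts.seq_le (t₁ := (12 : ℕ)) (t₂ := (n + 2) * ((30 : ℕ) + 30))
    (fun s₁ => s₁.real rStep 0 = s.real rVal (s.nat nLeave 0) / (- s.real rDir (s.nat nLeave 0)))
    (Halts.of_straight rfl (by decide) (by simp [Program.exec])) ?_ (by push_cast; linarith)
  intro s₁ hf₁ hstep
  refine (Halts.forLoop (N := n + 1) (t := (30 : ℕ))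
    (fun J s₂ => ∀ j, s₂.real rVal j = if j < J then x j else s.real rVal j)
    (by positivity) (by decide) (by rfl) ?_ ?_ ?_).mono ?_ ?_
  · intro s₂ hf
    simp [hf.nat nSize rfl, hf₁.nat nSize rfl, hn]
  · simp [hf₁.real rVal rfl]
  · rintro J - s₂ hf hJ hval
    refine Halts.of_straight rfl (by decide) ?_
    intro j
    have h1 : s₂.real rVal j = _ := hval j
    have h2 : s₂.real rVal J = _ := hval J
    simp only [Program.exec, State.putNat_real, State.putReal_real, NExpr.eval_var, hJ,
      RExpr.eval_add, RExpr.eval_get, RExpr.eval_mul, RExpr.eval_var, hf.real rStep rfl, hstep,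
      hf.real rDir rfl, hf₁.real rDir rfl, true_and, h1, h2]
    rcases lt_trichotomy j J with h | rfl | h
    · simp [h, h.ne, h.trans (Nat.lt_succ_self J)]
    · simp [hx]
    · simp [h.ne', not_lt.2 h.le, show ¬ j < J + 1 by omega]
  · push_cast
    linarith
  · rintro s₂ - h j hj
    rw [h, if_pos (by omega)]

/-- Eliminates the direction from the rows of the inverse, and moves the row and the set of the
entering column to the slot of the leaving column. -/
def pivotLoop : Program :=
  forLoop nI (.var nSize)
    (.setReal rTmp 0 (.get rInv (.var nLeave * .var nSize + .var nI) / .get rDir (.var nLeave)) ;;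
      forLoop nJ (.var nSize + 1)
        (.setReal rInv (.var nJ * .var nSize + .var nI)
          (.get rInv (.var nJ * .var nSize + .var nI) - .get rDir (.var nJ) * .var rTmp)) ;;
      .setReal rInv (.var nLeave * .var nSize + .var nI)
        (.get rInv (.var nSize * .var nSize + .var nI)) ;;
      .setReal rInv (.var nSize * .var nSize + .var nI) 0 ;;
      .setNat nSets (.var nLeave * .var nSize + .var nI)
        (.get nSets (.var nSize * .var nSize + .var nI)))

/-- The row of slot `n` takes part in the elimination and is moved to slot `r` afterwards, so the
cases in which the entering variable stays out of the basis (`r = n`) or not are treated alike. -/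
theorem halts_pivotLoop {s : State} (hn : s.nat nSize 0 = n) {r : ℕ} (hr : s.nat nLeave 0 = r)
    (hrn : r ≤ n) (M M' : ℕ → ℕ → ℝ) (hM : ∀ j k, M j k = s.real rInv (j * n + k))
    (hM' : ∀ j k, M' j k = M j k - s.real rDir j * (M r k / s.real rDir r)) :
    Halts O pivotLoop s ((n + 2) * ((n + 2) * 200)) fun s₁ =>
      (∀ j ≤ n, ∀ k < n, s₁.real rInv (j * n + k) =
        if j = n then 0 else if j = r then M' n k else M' j k) ∧
      ∀ j, ∀ k < n, s₁.nat nSets (j * n + k) =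
        s.nat nSets ((if j = r then n else j) * n + k) := by
  have hn0 : (0 : ℝ) ≤ n := Nat.cast_nonneg _
  refine (Halts.forLoop (N := n) (t := (n + 2) * 60 + 80)
    (fun K s₁ => (∀ j ≤ n, ∀ k < n, s₁.real rInv (j * n + k) =
        if k < K then (if j = n then 0 else if j = r then M' n k else M' j k) else M j k) ∧
      ∀ j, ∀ k < n, s₁.nat nSets (j * n + k) =
        if k < K then s.nat nSets ((if j = r then n else j) * n + k)
        else s.nat nSets (j * n + k))
    (by positivity) (by decide) (by rfl) (fun s₁ hf => ?_) ?_ ?_).mono ?_ ?_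
  · simp [hf.nat nSize rfl, hn]
  · simp [hM]
  · rintro K hK s₁ hf hK' ⟨hinv, hsets⟩
    have hn₁ : s₁.nat nSize 0 = n := by rw [hf.nat nSize rfl, hn]
    have hr₁ : s₁.nat nLeave 0 = r := by rw [hf.nat nLeave rfl, hr]
    refine Halts.seq_le (t₁ := (20 : ℕ)) (t₂ := (n + 2) * 60 + 60)
      (fun s₂ => s₂.real rTmp 0 = M r K / s.real rDir r)
      (Halts.of_straight rfl (by decide)
        (by simp [Program.exec, hn₁, hr₁, hK', hinv r hrn K hK, hf.real rDir rfl])) ?_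
      (by push_cast; linarith)
    intro s₂ hf₂ htmp
    have hn₂ : s₂.nat nSize 0 = n := by rw [hf₂.nat nSize rfl, hn₁]
    have hr₂ : s₂.nat nLeave 0 = r := by rw [hf₂.nat nLeave rfl, hr₁]
    have hK₂ : s₂.nat nI 0 = K := by rw [hf₂.nat nI rfl, hK']
    refine Halts.seq_le (t₁ := (n + 2) * ((30 : ℕ) + 30)) (t₂ := (60 : ℕ))
      (fun s₃ => ∀ j ≤ n, ∀ k < n, s₃.real rInv (j * n + k) =
        if k = K then M' j k else s₁.real rInv (j * n + k)) ?_ ?_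
      (by push_cast; linarith)
    · refine (Halts.forLoop (N := n + 1) (t := (30 : ℕ))
        (fun J s₃ => ∀ j ≤ n, ∀ k < n, s₃.real rInv (j * n + k) =
          if k = K ∧ j < J then M' j k else s₁.real rInv (j * n + k))
        (by positivity) (by decide) (by rfl) ?_ ?_ ?_).mono ?_ ?_
      · intro s₃ hf₃
        simp [hf₃.nat nSize rfl, hn₂]
      · simp [hf₂.real rInv rfl]
      · intro J hJ s₃ hf₃ hJ' h₃
        have hn₃ : s₃.nat nSize 0 = n := by rw [hf₃.nat nSize rfl, hn₂]
        have hK₃ : s₃.nat nI 0 = K := by rw [hf₃.nat nI rfl, hK₂]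
        refine Halts.of_straight rfl (by decide) ?_
        intro j hj k hk
        have h4 := h₃ j hj k hk
        have h5 := h₃ J (by omega) K hK
        have h6 := hinv J (by omega) K hK
        simp only [Program.exec, State.putNat_real, State.putReal_real, NExpr.eval_var, hJ',
          NExpr.eval_add, NExpr.eval_mul, hn₃, hK₃, true_and, cell_inj hk hK, RExpr.eval_sub,
          RExpr.eval_get, RExpr.eval_mul, RExpr.eval_var, hf₃.real rDir rfl, hf₂.real rDir rfl,
          hf.real rDir rfl, hf₃.real rTmp rfl, htmp, h4, h5, h6]
        by_cases hkK : k = K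
        · subst hkK
          rcases lt_trichotomy j J with h | rfl | h
          · simp [h, h.ne, h.trans (Nat.lt_succ_self J)]
          · simp [hM']
          · simp [h.ne', not_lt.2 h.le, show ¬ j < J + 1 by omega]
        · simp [hkK]
      · push_cast
        linarith
      · rintro s₃ - h j hj k hk
        rw [h j hj k hk]
        simp [show j < n + 1 by omega]
    · intro s₃ hf₃ h₃
      have hn₃ : s₃.nat nSize 0 = n := by rw [hf₃.nat nSize rfl, hn₂]
      have hr₃ : s₃.nat nLeave 0 = r := by rw [hf₃.nat nLeave rfl, hr₂]
      have hK₃ : s₃.nat nI 0 = K := by rw [hf₃.nat nI rfl, hK₂]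
      have hs₃ : s₃.nat nSets = s₁.nat nSets := by rw [hf₃.nat nSets rfl, hf₂.nat nSets rfl]
      refine Halts.of_straight rfl (by decide) ⟨?_, ?_⟩
      · intro j hj k hk
        have h4 := h₃ j hj k hk
        have h5 := h₃ n le_rfl K hK
        have h6 := hinv j hj k hk
        simp only [Program.exec, State.putNat_real, State.putReal_real, NExpr.eval_var,
          NExpr.eval_add, NExpr.eval_mul, hn₃, hK₃, hr₃, true_and, cell_inj hk hK,
          RExpr.eval_get, RExpr.eval_lit, State.putReal_nat, h4, h5, h6]
        by_cases hkK : k = K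
        · subst hkK
          simp
        · have : k < K + 1 ↔ k < K := by omega
          simp [hkK, this]
      · intro j k hk
        have h6 := hsets j k hk
        have h7 := hsets n K hK
        simp only [Program.exec, State.putNat_nat, NExpr.eval_var, State.putReal_nat,
          NExpr.eval_add, NExpr.eval_mul, hn₃, hK₃, hr₃, true_and, cell_inj hk hK,
          NExpr.eval_get, hs₃, h6, h7]
        by_cases hkK : k = K
        · subst hkK
          by_cases hjr : j = r <;> simp [hjr]
        · have : k < K + 1 ↔ k < K := by omega
          simp [hkK, this]
  · nlinarith
  · rintro s₁ - ⟨h1, h2⟩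
    refine ⟨fun j hj k hk => by rw [h1 j hj k hk, if_pos hk], fun j k hk => ?_⟩
    rw [h2 j k hk, if_pos hk]

open Finset

/-! ### Bases of the linear program in the memory -/

/-- Replacing slot `r` by slot `n` drops the term of slot `r` from a sum over the slots. -/
theorem sum_range_replace {n r : ℕ} (hr : r ≤ n) (f : ℕ → ℝ) (hf : f r = 0) :
    ∑ j ∈ range n, f (if j = r then n else j) = ∑ j ∈ range (n + 1), f j := by
  rw [sum_range_succ]
  rcases hr.lt_or_eq with h | rfl
  · have : ∀ j ∈ range n, f (if j = r then n else j) = f j + if j = r then f n else 0 := by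
      intro j _
      split_ifs with hj
      · rw [hj, hf, zero_add]
      · rw [add_zero]
    rw [sum_congr rfl this, sum_add_distrib, sum_ite_eq', if_pos (mem_range.2 h)]
  · rw [hf, add_zero]
    refine sum_congr rfl fun j hj => ?_
    rw [if_neg (mem_range.1 hj).ne]

/-- Adds the entry `-1` of the entering column to the direction, and its cost to the reduced
cost. -/
def shiftStep : Program :=
  .setReal rDir (.var nSize) (.get rDir (.var nSize) - 1) ;;
    .setReal rRed 0 (.var rRed - .get rCost (.var nSize))

/-- Chooses the sign such that the cost does not increase along the direction. -/
def signStep : Program :=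
  .setNat nLeave 0 0 ;;
    .ite (.realLt 0 (.var rRed)) (.setReal rSign 0 (0 - 1)) (.setReal rSign 0 1)

/-- Moves the value and the cost of the entering variable to the slot of the leaving one. -/
def moveStep : Program :=
  .setReal rVal (.var nLeave) (.get rVal (.var nSize)) ;;
    .setReal rCost (.var nLeave) (.get rCost (.var nSize))

/-- Lets the variable in slot `n` enter the basis. -/
def enter : Program :=
  .setReal rRed 0 0 ;; directionLoop ;; shiftStep ;; signStep ;; ratioLoop ;; stepLoop ;;
    moveStep ;; pivotLoop

/-- The effect of `enter` on the memory, for a direction `d = σ u` with `σ = ± 1`, a leaving slot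
`r`, and `p` the slot whose content ends up in slot `j`. -/
theorem halts_enter_memory {s : State} (hn : s.nat nSize 0 = n)
    (u : ℕ → ℝ)
    (hu : ∀ j, u j = (∑ k ∈ range n, s.real rInv (j * n + k) * s.real rCol k) -
      if j = n then 1 else 0) :
    Halts O enter s ((n + 2) * ((n + 2) * 800)) fun s₁ => ∃ (σ : ℝ) (d : ℕ → ℝ) (r : ℕ),
      (∀ j, d j = σ * u j) ∧ (∑ j ∈ range (n + 1), s.real rCost j * d j < 0 ∨
        σ = 1 ∧ ∑ j ∈ range (n + 1), s.real rCost j * d j ≤ 0) ∧ r ≤ n ∧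
      (∀ j ≤ n, d j < 0 → d r < 0 ∧ s.real rVal r / (- d r) ≤ s.real rVal j / (- d j)) ∧
      ∀ j < n, ∀ p, p = (if j = r then n else j) →
        s₁.real rVal j = s.real rVal p + s.real rVal r / (- d r) * d p ∧
        s₁.real rCost j = s.real rCost p ∧
        ∀ k < n, s₁.real rInv (j * n + k) =
            s.real rInv (p * n + k) - d p * (s.real rInv (r * n + k) / d r) ∧
          s₁.real rInv (n * n + k) = 0 ∧
          s₁.nat nSets (j * n + k) = s.nat nSets (p * n + k) := by
  have hn0 : (0 : ℝ) ≤ n := Nat.cast_nonneg _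
  refine Halts.seq_le (t₁ := (4 : ℕ)) (t₂ := (n + 2) * ((n + 2) * 700))
    (fun s₁ => s₁.real rRed 0 = 0)
    (Halts.of_straight rfl (by decide) (by simp [Program.exec])) ?_ (by push_cast; nlinarith)
  intro s₁ f₁ h₁
  have hn₁ : s₁.nat nSize 0 = n := by rw [f₁.nat nSize rfl, hn]
  refine Halts.seq_le (t₂ := (n + 2) * ((n + 2) * 500)) _
    (halts_directionLoop hn₁ h₁
      (fun j => ∑ k ∈ range n, s.real rInv (j * n + k) * s.real rCol k)
      (by simp [f₁.real rInv rfl, f₁.real rCol rfl])) ?_ (by nlinarith)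
  rintro s₂ f₂ ⟨hd₂, hr₂⟩
  have hn₂ : s₂.nat nSize 0 = n := by rw [f₂.nat nSize rfl, hn₁]
  have hc₂ : s₂.real rCost = s.real rCost := by rw [f₂.real rCost rfl, f₁.real rCost rfl]
  have hred : s₂.real rRed 0 - s₂.real rCost n = ∑ j ∈ range (n + 1), s.real rCost j * u j := by
    rw [hr₂, f₁.real rCost rfl, hc₂]
    simp only [hu, mul_sub, sum_sub_distrib, mul_ite, mul_one, mul_zero, sum_ite_eq',
      mem_range, Nat.lt_succ_self, if_true]
  refine Halts.seq_le (t₁ := (30 : ℕ)) (t₂ := (n + 2) * ((n + 2) * 450))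
    (fun s₃ => (∀ j ≤ n, s₃.real rDir j = u j) ∧
      s₃.real rRed 0 = ∑ j ∈ range (n + 1), s.real rCost j * u j)
    (Halts.of_straight rfl (by decide) ⟨?_, ?_⟩) ?_ (by push_cast; nlinarith)
  · intro j hj
    simp only [Program.exec, shiftStep, State.putReal_real, NExpr.eval_var, hn₂, RExpr.eval_sub,
      RExpr.eval_get, RExpr.eval_lit, true_and, hu]
    by_cases h : j = n
    · simp [h, hd₂ n le_rfl]
    · simp [h, hd₂ j hj]
  · simp [Program.exec, shiftStep, ← hred, hn₂]
  rintro s₃ f₃ ⟨hd₃, hr₃⟩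
  have hn₃ : s₃.nat nSize 0 = n := by rw [f₃.nat nSize rfl, hn₂]
  refine Halts.seq_le (t₁ := (20 : ℕ)) (t₂ := (n + 2) * ((n + 2) * 420))
    (fun s₄ => s₄.nat nLeave 0 = 0 ∧ s₄.real rSign 0 = if 0 < s₃.real rRed 0 then -1 else 1)
    (Halts.of_straight rfl (by decide) ?_) ?_ (by push_cast; nlinarith)
  · by_cases h : 0 < s₃.real rRed 0 <;> simp [Program.exec, signStep, h]
  rintro s₄ f₄ ⟨hl₄, hs₄⟩
  have hn₄ : s₄.nat nSize 0 = n := by rw [f₄.nat nSize rfl, hn₃]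
  refine Halts.seq_le (t₂ := (n + 2) * ((n + 2) * 300)) _
    (halts_ratioLoop hn₄ hl₄ _ fun _ => rfl) ?_ (by nlinarith)
  rintro s₅ f₅ ⟨hd₅, hl₅, hmin⟩
  have hn₅ : s₅.nat nSize 0 = n := by rw [f₅.nat nSize rfl, hn₄]
  obtain ⟨r, hr⟩ : ∃ r, s₅.nat nLeave 0 = r := ⟨_, rfl⟩
  obtain ⟨σ, hσ⟩ : ∃ σ, s₄.real rSign 0 = σ := ⟨_, rfl⟩
  have hx₅ : s₅.real rVal = s.real rVal := by
    rw [f₅.real rVal rfl, f₄.real rVal rfl, f₃.real rVal rfl, f₂.real rVal rfl, f₁.real rVal rfl]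
  have hd : ∀ j ≤ n, s₅.real rDir j = σ * u j := by
    intro j hj
    rw [hd₅ j hj, hσ, f₄.real rDir rfl, hd₃ j hj]
  rw [hr] at hl₅
  refine Halts.seq_le (t₂ := (n + 2) * ((n + 2) * 220)) _ (halts_stepLoop hn₅ _ fun _ => rfl) ?_
    (by nlinarith)
  intro s₆ f₆ hx₆
  have hn₆ : s₆.nat nSize 0 = n := by rw [f₆.nat nSize rfl, hn₅]
  have hr₆ : s₆.nat nLeave 0 = r := by rw [f₆.nat nLeave rfl, hr]
  have hc₆ : s₆.real rCost = s.real rCost := by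
    rw [f₆.real rCost rfl, f₅.real rCost rfl, f₄.real rCost rfl, f₃.real rCost rfl, hc₂]
  refine Halts.seq_le (t₁ := (20 : ℕ)) (t₂ := (n + 2) * ((n + 2) * 200))
    (fun s₇ => (∀ j, s₇.real rVal j = if j = r then s₆.real rVal n else s₆.real rVal j) ∧
      ∀ j, s₇.real rCost j = if j = r then s.real rCost n else s.real rCost j)
    (Halts.of_straight rfl (by decide)
      (by simp [Program.exec, moveStep, hr₆, hn₆, hc₆])) ?_ (by push_cast; nlinarith)
  rintro s₇ f₇ ⟨hx₇, hc₇⟩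
  have hn₇ : s₇.nat nSize 0 = n := by rw [f₇.nat nSize rfl, hn₆]
  have hr₇ : s₇.nat nLeave 0 = r := by rw [f₇.nat nLeave rfl, hr₆]
  have hM₇ : s₇.real rInv = s.real rInv := by
    rw [f₇.real rInv rfl, f₆.real rInv rfl, f₅.real rInv rfl, f₄.real rInv rfl, f₃.real rInv rfl,
      f₂.real rInv rfl, f₁.real rInv rfl]
  have hS₇ : s₇.nat nSets = s.nat nSets := by
    rw [f₇.nat nSets rfl, f₆.nat nSets rfl, f₅.nat nSets rfl, f₄.nat nSets rfl, f₃.nat nSets rfl,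
      f₂.nat nSets rfl, f₁.nat nSets rfl]
  have hd₇ : ∀ j ≤ n, s₇.real rDir j = σ * u j := by
    intro j hj
    rw [f₇.real rDir rfl, f₆.real rDir rfl, hd j hj]
  refine (halts_pivotLoop hn₇ hr₇ hl₅ _ _ (fun _ _ => rfl) fun _ _ => rfl).mono le_rfl ?_
  rintro s₈ f₈ ⟨hM₈, hS₈⟩
  refine ⟨σ, fun j => σ * u j, r, fun _ => rfl, ?_, hl₅, ?_, ?_⟩
  · simp only [mul_left_comm _ σ, ← mul_sum, ← hr₃]
    rw [hσ] at hs₄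
    split_ifs at hs₄ with h
    · left; rw [hs₄]; linarith
    · right; exact ⟨hs₄, by rw [hs₄]; linarith⟩
  · intro j hj hdj
    have h := hmin j hj
    rw [← hd₅ j hj, hr, ← hd₅ r hl₅, hd j hj, hd r hl₅, f₄.real rVal rfl, f₃.real rVal rfl,
      f₂.real rVal rfl, f₁.real rVal rfl] at h
    exact h hdj
  · intro j hj p hp
    have hpn : p ≤ n := by rw [hp]; split_ifs <;> omega
    refine ⟨?_, ?_, fun k hk => ⟨?_, ?_, ?_⟩⟩
    · have h1 : s₈.real rVal j = s₆.real rVal p := by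
        rw [f₈.real rVal rfl, hx₇, hp]
        split_ifs <;> rfl
      rw [h1, hx₆ p hpn, hx₅, hr, hd r hl₅, hd p hpn]
    · rw [f₈.real rCost rfl, hc₇, hp]
      split_ifs <;> rfl
    · rw [hM₈ j hj.le k hk, if_neg hj.ne, hM₇, hd₇ r hl₅, hp]
      split_ifs
      · rw [hd₇ n le_rfl]
      · rw [hd₇ j hj.le]
    · rw [hM₈ n le_rfl k hk, if_pos rfl]
    · rw [hS₈ j k hk, hS₇, hp]

/-- The memory holds a basis of the linear program in equality form with right-hand side `b`: slot
`j < n` holds the basic variable `col j`, its cost, its value and the `j`-th row of the inverse of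
the basis matrix, and, if the variable belongs to a set, the 0/1 vector of this set. Slot `n` is
reserved for an entering column; its row is zero. -/
structure Tableau (I : CoverInstance n) (s : State) (col : ℕ → I.Col ⊕ Fin n) (b : Fin n → ℝ) :
    Prop where
  size : s.nat nSize 0 = n
  val_nonneg : ∀ j < n, 0 ≤ s.real rVal j
  cost_eq : ∀ j < n, s.real rCost j = I.colCost (col j)
  sets : ∀ j < n, ∀ S, col j = .inl S → s.HoldsSet nSets (j * n) S.1
  inverse : ∀ i k : Fin n, ∑ j ∈ range n, I.colVec (col j) i * s.real rInv (j * n + k) =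
    if i = k then 1 else 0
  row_zero : ∀ k < n, s.real rInv (n * n + k) = 0
  balance : ∀ i, ∑ j ∈ range n, I.colVec (col j) i * s.real rVal j = b i

/-- The objective value of the basic solution held in the memory. -/
def totalCost (n : ℕ) (s : State) : ℝ := ∑ j ∈ range n, s.real rCost j * s.real rVal j

/-- Entering a variable with value `w` keeps a feasible basis and does not cost more than the
variable itself. -/
theorem halts_enter {s : State} {col : ℕ → I.Col ⊕ Fin n} {b : Fin n → ℝ} (hT : Tableau I s col b)
    (v : I.Col ⊕ Fin n) (hcol : ∀ k : Fin n, s.real rCol k = I.colVec v k)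
    (hcost : s.real rCost n = I.colCost v) (hval : 0 ≤ s.real rVal n)
    (hset : ∀ S, v = .inl S → s.HoldsSet nSets (n * n) S.1) :
    Halts O enter s ((n + 2) * ((n + 2) * 800)) fun s₁ =>
      (∃ col', Tableau I s₁ col' fun i => b i + s.real rVal n * I.colVec v i) ∧
      totalCost n s₁ ≤ totalCost n s + s.real rVal n * I.colCost v := by
  refine (halts_enter_memory hT.size _ fun _ => rfl).mono le_rfl ?_
  rintro s₁ hf ⟨σ, d, r, hd, hred, hr, hmin, hmem⟩
  -- The variables in the slots `0, …, n`, including the entering one.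
  obtain ⟨var, hvar⟩ : ∃ var : ℕ → I.Col ⊕ Fin n, ∀ j, var j = if j = n then v else col j :=
    ⟨_, fun _ => rfl⟩
  have hvn : var n = v := by simp [hvar]
  have hvj : ∀ j ∈ range n, var j = col j := fun j hj => by
    rw [hvar, if_neg (mem_range.1 hj).ne]
  have hC : ∀ j ≤ n, s.real rCost j = I.colCost (var j) := by
    intro j hj
    rcases hj.lt_or_eq with h | rfl
    · rw [hT.cost_eq j h, hvj j (mem_range.2 h)]
    · rw [hcost, hvn]
  have hX : ∀ j ≤ n, 0 ≤ s.real rVal j := by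
    intro j hj
    rcases hj.lt_or_eq with h | rfl
    · exact hT.val_nonneg j h
    · exact hval
  have hI : ∀ i k : Fin n, ∑ j ∈ range (n + 1), I.colVec (var j) i * s.real rInv (j * n + k) =
      if i = k then 1 else 0 := by
    intro i k
    rw [sum_range_succ, hT.row_zero k k.2, mul_zero, add_zero, ← hT.inverse]
    exact sum_congr rfl fun j hj => by rw [hvj j hj]
  -- The direction lies in the kernel of the matrix formed by these `n + 1` columns.
  have hker : ∀ i, ∑ j ∈ range (n + 1), I.colVec (var j) i * d j = 0 := by
    intro i
    have h1 : ∀ j, I.colVec (var j) i * d j =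
        σ * (∑ k : Fin n, I.colVec (var j) i * s.real rInv (j * n + k) * s.real rCol k -
          if j = n then I.colVec (var j) i else 0) := by
      intro j
      rw [hd, Finset.sum_range]
      simp only [mul_assoc, ← mul_sum]
      split_ifs <;> ring
    simp only [h1, ← mul_sum, sum_sub_distrib, sum_ite_eq', mem_range, Nat.lt_succ_self, if_true]
    rw [sum_comm]
    simp only [← sum_mul, hI, ite_mul, one_mul, zero_mul, sum_ite_eq, mem_univ, if_true, hcol, hvn,
      sub_self, mul_zero]
  have hneg : ∃ j ≤ n, d j < 0 := by
    rcases hred with h | ⟨rfl, -⟩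
    · obtain ⟨j, hj, hlt⟩ := exists_lt_of_sum_lt
        (show ∑ j ∈ range (n + 1), s.real rCost j * d j < ∑ j ∈ range (n + 1), (0 : ℝ) by
          simpa using h)
      have hj' : j ≤ n := Nat.lt_succ_iff.1 (mem_range.1 hj)
      refine ⟨j, hj', ?_⟩
      by_contra h0
      have := mul_nonneg ((hC j hj').symm ▸ I.colCost_nonneg (var j)) (not_lt.1 h0)
      linarith
    · refine ⟨n, le_rfl, ?_⟩
      rw [hd, sum_eq_zero fun k hk => by rw [hT.row_zero k (mem_range.1 hk), zero_mul]]
      norm_num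
  obtain ⟨j₀, hj₀, hlt⟩ := hneg
  have hdr : d r < 0 := (hmin j₀ hj₀ hlt).1
  obtain ⟨θ, hθ⟩ : ∃ θ, s.real rVal r / (- d r) = θ := ⟨_, rfl⟩
  have hθ0 : 0 ≤ θ := hθ ▸ div_nonneg (hX r hr) (by linarith)
  have hθr : s.real rVal r + θ * d r = 0 := by
    rw [← hθ, div_neg, neg_mul, div_mul_cancel₀ _ hdr.ne, add_neg_cancel]
  have hred' : ∑ j ∈ range (n + 1), s.real rCost j * d j ≤ 0 := by
    rcases hred with h | h
    exacts [h.le, h.2]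
  obtain ⟨π, hπ⟩ : ∃ π : ℕ → ℕ, ∀ j, π j = if j = r then n else j := ⟨_, fun _ => rfl⟩
  have hπn : ∀ j < n, π j ≤ n := fun j hj => by rw [hπ]; split_ifs <;> omega
  have hsum : ∀ f : ℕ → ℝ, f r = 0 → ∑ j ∈ range n, f (π j) = ∑ j ∈ range (n + 1), f j := by
    intro f hf
    simp only [hπ]
    exact sum_range_replace hr f hf
  have hval' : ∀ j < n, s₁.real rVal j = s.real rVal (π j) + θ * d (π j) := fun j hj => by
    rw [(hmem j hj _ (hπ j)).1, hθ]
  have hcost' : ∀ j < n, s₁.real rCost j = s.real rCost (π j) := fun j hj =>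
    (hmem j hj _ (hπ j)).2.1
  refine ⟨⟨fun j => var (π j), ?_, ?_, ?_, ?_, ?_, ?_, ?_⟩, ?_⟩
  · rw [hf.nat nSize rfl, hT.size]
  · intro j hj
    rw [hval' j hj]
    rcases lt_or_ge (d (π j)) 0 with h | h
    · have h1 := (hmin (π j) (hπn j hj) h).2
      rw [hθ, le_div_iff₀ (by linarith)] at h1
      linarith
    · exact add_nonneg (hX _ (hπn j hj)) (mul_nonneg hθ0 h)
  · intro j hj
    rw [hcost' j hj, hC _ (hπn j hj)]
  · intro j hj S hS i
    rw [((hmem j hj _ (hπ j)).2.2 i i.2).2.2]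
    rcases (hπn j hj).lt_or_eq with h | h
    · exact hT.sets (π j) h S (by rw [← hvj _ (mem_range.2 h), hS]) i
    · rw [h]
      exact hset S (hvn.symm.trans ((congrArg var h).symm.trans hS)) i
  · intro i k
    rw [sum_congr rfl fun j hj => by
      rw [((hmem j (mem_range.1 hj) _ (hπ j)).2.2 k k.2).1]]
    rw [hsum (fun j => I.colVec (var j) i * (s.real rInv (j * n + k) -
      d j * (s.real rInv (r * n + k) / d r))) ?_]
    · simp only [mul_sub, sum_sub_distrib, hI, ← mul_assoc, ← sum_mul, hker, zero_mul, sub_zero]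
    · rw [mul_div_cancel₀ _ hdr.ne, sub_self, mul_zero]
  · intro k hk
    have h0 : 0 < n := by omega
    exact ((hmem 0 h0 _ (hπ 0)).2.2 k hk).2.1
  · intro i
    rw [sum_congr rfl fun j hj => by rw [hval' j (mem_range.1 hj)]]
    rw [hsum (fun j => I.colVec (var j) i * (s.real rVal j + θ * d j)) (by rw [hθr, mul_zero])]
    simp only [mul_add, sum_add_distrib, mul_left_comm _ θ, ← mul_sum, hker, mul_zero, add_zero]
    rw [sum_range_succ, hvn, ← hT.balance i, mul_comm (I.colVec v i)]
    congr 1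
    exact sum_congr rfl fun j hj => by rw [hvj j hj]
  · unfold totalCost
    rw [sum_congr rfl fun j hj => by
      rw [hval' j (mem_range.1 hj), hcost' j (mem_range.1 hj)]]
    rw [hsum (fun j => s.real rCost j * (s.real rVal j + θ * d j)) (by rw [hθr, mul_zero])]
    simp only [mul_add, sum_add_distrib, mul_left_comm _ θ, ← mul_sum]
    rw [sum_range_succ, hcost, mul_comm (I.colCost v)]
    have := mul_nonpos_of_nonneg_of_nonpos hθ0 hred'
    linarith

/-! ### The solution that belongs to a basis -/

namespace Tableau

variable {s : State} {col : ℕ → I.Col ⊕ Fin n} {b : Fin n → ℝ}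

theorem linearIndependent (hT : Tableau I s col b) :
    LinearIndependent ℝ fun j : Fin n => I.colVec (col j) := by
  have h : (Matrix.of fun i j : Fin n => I.colVec (col j) i) *
      (Matrix.of fun j k : Fin n => s.real rInv (j * n + k)) = 1 := by
    ext i k
    rw [Matrix.mul_apply, Matrix.one_apply, ← hT.inverse, Finset.sum_range]
    rfl
  exact Matrix.linearIndependent_cols_iff_isUnit.2 (IsUnit.of_mul_eq_one _ h)

theorem col_injective (hT : Tableau I s col b) : Function.Injective fun j : Fin n => col j :=
  fun _ _ h => hT.linearIndependent.injective (congrArg I.colVec h)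

end Tableau

/-- The solution of the covering linear program that belongs to a basis for the right-hand side
`N, …, N`, scaled by `1 / N`. -/
noncomputable def solution (s : State) (col : ℕ → I.Col ⊕ Fin n) (N : ℝ) (S : I.Col) : ℝ :=
  ∑ j ∈ range n, if col j = .inl S then s.real rVal j / N else 0

/-- Sums over the sets, weighted by the solution, are sums over the slots. -/
theorem sum_solution_mul (s : State) (col : ℕ → I.Col ⊕ Fin n) (N : ℝ) (f : I.Col → ℝ) :
    ∑ S, solution s col N S * f S =
      ∑ j ∈ range n, s.real rVal j / N * Sum.elim f (fun _ => 0) (col j) := by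
  simp only [solution, sum_mul]
  rw [sum_comm]
  refine sum_congr rfl fun j _ => ?_
  cases col j with
  | inl S => simp
  | inr i => simp

namespace Tableau

variable {s : State} {col : ℕ → I.Col ⊕ Fin n} {N : ℝ}

theorem objective_solution {b : Fin n → ℝ} (hT : Tableau I s col b) :
    I.objective (solution s col N) = totalCost n s / N := by
  simp only [CoverInstance.objective, mul_comm (I.cost _), sum_solution_mul, totalCost, sum_div]
  refine sum_congr rfl fun j hj => ?_
  rw [hT.cost_eq j (mem_range.1 hj), CoverInstance.colCost]
  ring

theorem coverage_solution (hN : 0 < N) (hT : Tableau I s col fun _ => N) (i : Fin n) :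
    I.coverage (solution s col N) i - 1 =
      ∑ j ∈ range n, s.real rVal j / N *
        Sum.elim (fun _ => 0) (fun i' => Pi.single (M := fun _ => ℝ) i' 1 i) (col j) := by
  have hb : ∑ j ∈ range n, I.colVec (col j) i * s.real rVal j / N = 1 := by
    rw [← sum_div, hT.balance, div_self hN.ne']
  rw [CoverInstance.coverage_apply, sum_solution_mul, sub_eq_iff_eq_add]
  refine Eq.trans ?_ (congrArg _ hb)
  rw [← sum_add_distrib]
  refine sum_congr rfl fun j _ => ?_
  unfold CoverInstance.colVec
  cases col j with
  | inl S => simp; ring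
  | inr i => simp; ring

theorem isBasicSolution (hN : 0 < N) (hT : Tableau I s col fun _ => N) :
    I.IsBasicSolution (solution s col N) := by
  have hv : ∀ j ∈ range n, 0 ≤ s.real rVal j / N := fun j hj =>
    div_nonneg (hT.val_nonneg j (mem_range.1 hj)) hN.le
  refine ⟨⟨fun i => ?_, fun S => sum_nonneg fun j hj => ?_⟩, ?_⟩
  · rw [← sub_nonneg, hT.coverage_solution hN]
    refine sum_nonneg fun j hj => mul_nonneg (hv j hj) ?_
    cases col j with
    | inl S => simp
    | inr i' => simp only [Sum.elim_inr, Pi.single_apply]; split_ifs <;> norm_num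
  · split_ifs
    exacts [hv j hj, le_rfl]
  · -- Every nonzero variable is in the basis.
    have h1 : ∀ S : {S : I.Col // solution s col N S ≠ 0}, ∃ j : Fin n, col j = .inl S.1 := by
      rintro ⟨S, hS⟩
      obtain ⟨j, hj, h⟩ := exists_ne_zero_of_sum_ne_zero hS
      exact ⟨⟨j, mem_range.1 hj⟩, by by_contra h'; exact h (if_neg h')⟩
    have h2 : ∀ i : {i : Fin n // I.coverage (solution s col N) i - 1 ≠ 0},
        ∃ j : Fin n, col j = .inr i.1 := by
      rintro ⟨i, hi⟩
      rw [hT.coverage_solution hN] at hi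
      obtain ⟨j, hj, h⟩ := exists_ne_zero_of_sum_ne_zero hi
      refine ⟨⟨j, mem_range.1 hj⟩, ?_⟩
      show col j = _
      have h' := right_ne_zero_of_mul h
      cases hc : col j with
      | inl S => simp [hc] at h'
      | inr i' =>
        rw [hc, Sum.elim_inr, Pi.single_apply] at h'
        obtain rfl : i = i' := by by_contra h''; exact h' (if_neg h'')
        rfl
    choose f hf using h1
    choose g hg using h2
    have hinj : Function.Injective (Sum.elim f g) := by
      intro v w h
      have h' := congrArg (fun j : Fin n => col j) h
      rcases v with v | v <;> rcases w with w | w <;>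
        simp only [Sum.elim_inl, Sum.elim_inr, hf, hg, Sum.inl.injEq, Sum.inr.injEq,
          reduceCtorEq] at h'
      · rw [Subtype.ext h']
      · rw [Subtype.ext h']
    convert hT.linearIndependent.comp _ hinj using 1
    ext v
    rcases v with v | v
    · simp [hf, CoverInstance.colVec]
    · simp [hg, CoverInstance.colVec]

end Tableau

/-! ### Prices and the bound for the cost -/

/-- The price of an element that has been covered `k` times: it decays geometrically, and drops to
zero once the element is covered `N` times. -/
def price (m N k : ℕ) : ℚ := if k < N then (1 - 1 / m) ^ k else 0

/-- The number of elements that have been covered less than `N` times. -/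
def numActive {n : ℕ} (N : ℕ) (k : Fin n → ℕ) : ℕ := #{i | k i < N}

section Potential

variable {n m N : ℕ} {k k' : Fin n → ℕ}

theorem price_base_pos (hm : 2 ≤ m) : (0 : ℚ) < 1 - 1 / m := by
  have : (2 : ℚ) ≤ m := by exact_mod_cast hm
  rw [sub_pos, div_lt_one (by linarith)]
  linarith

theorem price_base_pos_real (hm : 2 ≤ m) : (0 : ℝ) < 1 - 1 / m := by
  have h := (Rat.cast_pos (K := ℝ)).2 (price_base_pos hm)
  push_cast at h
  exact h

theorem price_nonneg (hm : 2 ≤ m) (N k : ℕ) : 0 ≤ price m N k := by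
  unfold price
  split_ifs
  exacts [(pow_pos (price_base_pos hm) _).le, le_rfl]

theorem price_pos_iff (hm : 2 ≤ m) {N k : ℕ} : 0 < price m N k ↔ k < N := by
  unfold price
  split_ifs with h
  · exact iff_of_true (pow_pos (price_base_pos hm) _) h
  · exact iff_of_false (lt_irrefl _) h

theorem price_succ_le (hm : 2 ≤ m) (N k : ℕ) :
    price m N (k + 1) ≤ price m N k - 1 / m * price m N k := by
  have h : price m N k - 1 / m * price m N k = (1 - 1 / m) * price m N k := by ring
  rw [h]
  by_cases hk : k + 1 < N
  · rw [price, price, if_pos hk, if_pos (by omega), pow_succ, mul_comm]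
  · rw [price, if_neg hk]
    exact mul_nonneg (price_base_pos hm).le (price_nonneg hm N k)

/-- Buying `S` with weight `1` takes the fraction `1 / m` of its price away. -/
theorem sum_price_le (hm : 2 ≤ m) (S : Finset (Fin n))
    (hk : ∀ i, k' i = k i + if i ∈ S then 1 else 0) :
    ∑ i, (price m N (k' i) : ℝ) ≤
      ∑ i, (price m N (k i) : ℝ) - 1 / m * ∑ i ∈ S, (price m N (k i) : ℝ) := by
  have h : ∑ i ∈ S, (price m N (k i) : ℝ) = ∑ i, if i ∈ S then (price m N (k i) : ℝ) else 0 := by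
    rw [sum_ite_mem, univ_inter]
  rw [h, mul_sum, ← sum_sub_distrib]
  refine sum_le_sum fun i _ => ?_
  rw [hk]
  split_ifs
  · have h := (Rat.cast_le (K := ℝ)).2 (price_succ_le hm N (k i))
    push_cast at h
    exact h
  · simp

/-- The cost that has been paid is bounded while more than `n / m` elements are active, because
each of them still contributes at least `(1 - 1 / m) ^ N` to the sum of the prices. -/
theorem cost_le_of_active {L : ℕ} {R Γ : ℝ} (hm : 16 ≤ m) (hN : N = m * m * L) (hL : m ≤ 2 ^ L)
    (hR : 0 < R) (hn : 0 < n) (hact : n < m * numActive N k)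
    (hpot : ∑ i, (price m N (k i) : ℝ) ≤ n * Real.exp (-(1 / m * (1 - 1 / m) / R) * Γ)) :
    Γ ≤ R * N * (1 + 4 / m) := by
  obtain ⟨e, he⟩ : ∃ e : ℝ, 1 / m = e := ⟨_, rfl⟩
  have hm' : (16 : ℝ) ≤ m := by exact_mod_cast hm
  have hn' : (0 : ℝ) < n := by exact_mod_cast hn
  have he0 : 0 < e := he ▸ by positivity
  have he1 : e ≤ 1 / 16 := he ▸ by gcongr
  have hme : (m : ℝ) * e = 1 := by rw [← he]; field_simp
  have hq : 0 < 1 - e := by linarith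
  rw [he] at hpot
  have h1 : (numActive N k : ℝ) * (1 - e) ^ N ≤ ∑ i, (price m N (k i) : ℝ) := by
    calc (numActive N k : ℝ) * (1 - e) ^ N = ∑ i with k i < N, (1 - e) ^ N := by
          rw [sum_const, nsmul_eq_mul, numActive]
      _ ≤ ∑ i with k i < N, (price m N (k i) : ℝ) := by
          refine sum_le_sum fun i hi => ?_
          have hi' : k i < N := (mem_filter.1 hi).2
          rw [price, if_pos hi']
          push_cast
          rw [he]
          exact pow_le_pow_of_le_one hq.le (by linarith) hi'.le
      _ ≤ ∑ i, (price m N (k i) : ℝ) :=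
          sum_le_sum_of_subset_of_nonneg (subset_univ _) fun i _ _ => by
            exact_mod_cast price_nonneg (by omega) N (k i)
  have h2 : (n : ℝ) * e < numActive N k := by
    have : (n : ℝ) < m * numActive N k := by exact_mod_cast hact
    calc (n : ℝ) * e < m * numActive N k * e := by gcongr
      _ = numActive N k := by rw [mul_right_comm, hme, one_mul]
  have h3 : Real.exp (-L) ≤ e := by
    rw [Real.exp_neg, ← he, one_div]
    refine inv_anti₀ (by linarith) ?_
    calc (m : ℝ) ≤ 2 ^ L := by exact_mod_cast hL
      _ ≤ Real.exp 1 ^ L := by gcongr; linarith [Real.add_one_le_exp 1]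
      _ = Real.exp L := by rw [← Real.exp_nat_mul, mul_one]
  have h4 : Real.exp (-(N * (e / (1 - e)))) ≤ (1 - e) ^ N := by
    have h5 : Real.exp (-(e / (1 - e))) ≤ 1 - e := by
      rw [← Real.le_log_iff_exp_le hq]
      have := Real.one_sub_inv_le_log_of_pos hq
      have h6 : 1 - (1 - e)⁻¹ = -(e / (1 - e)) := by field_simp; ring
      linarith
    calc Real.exp (-(N * (e / (1 - e)))) = Real.exp (-(e / (1 - e))) ^ N := by
          rw [← Real.exp_nat_mul]; congr 1; ring
      _ ≤ (1 - e) ^ N := by gcongr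
  have h5 : (n : ℝ) * Real.exp (-L + -(N * (e / (1 - e)))) ≤
      n * Real.exp (-(e * (1 - e) / R) * Γ) := by
    rw [Real.exp_add]
    calc (n : ℝ) * (Real.exp (-L) * Real.exp (-(N * (e / (1 - e)))))
        ≤ n * (e * (1 - e) ^ N) := by gcongr
      _ = n * e * (1 - e) ^ N := by ring
      _ ≤ numActive N k * (1 - e) ^ N := by gcongr
      _ ≤ _ := h1.trans hpot
  have h6 := Real.exp_le_exp.1 (le_of_mul_le_mul_left h5 hn')
  have hNL : (L : ℝ) = N * e ^ 2 := by
    rw [hN]; push_cast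
    calc (L : ℝ) = (m * e) * (m * e) * L := by rw [hme]; ring
      _ = _ := by ring
  have h7 : e * (1 - e) / R * Γ ≤ N * (e ^ 2 + e / (1 - e)) := by
    rw [hNL] at h6; linarith
  have h8 : e ^ 2 + e / (1 - e) ≤ e * (1 - e) * (1 + 4 * e) := by
    have : e / (1 - e) ≤ e + e ^ 2 + 2 * e ^ 3 := by
      rw [div_le_iff₀ hq]
      nlinarith [pow_pos he0 3, mul_pos he0 he0]
    nlinarith [pow_pos he0 3, mul_pos he0 he0]
  have h9 : e * (1 - e) / R * Γ ≤ e * (1 - e) / R * (R * N * (1 + 4 * e)) := by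
    calc e * (1 - e) / R * Γ ≤ N * (e ^ 2 + e / (1 - e)) := h7
      _ ≤ N * (e * (1 - e) * (1 + 4 * e)) := by gcongr
      _ = _ := by field_simp
  have h10 := le_of_mul_le_mul_left h9 (by positivity)
  rwa [← he, mul_one_div] at h10

/-- The bounds on the cost `Γ` paid so far, where `R` is the optimum value. As long as more than
`n / m` elements are active, the sum of the prices decays exponentially in `Γ`; afterwards each
active element may cost `N` more. -/
structure CostBounds (m N : ℕ) (R Γ : ℝ) (k : Fin n → ℕ) : Prop where
  many : n < m * numActive N k →
    ∑ i, (price m N (k i) : ℝ) ≤ n * Real.exp (-(1 / m * (1 - 1 / m) / R) * Γ)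
  few : m * numActive N k ≤ n →
    Γ + N * numActive N k ≤ R * N * (1 + 4 / m) + 1 + N * (n / m)

/-- A nearly densest set has positive price, hence an active element. -/
theorem exists_active (hm : 2 ≤ m) {S : Finset (Fin n)} {c R : ℝ} (hc : 0 < c)
    (hact : 0 < numActive N k)
    (hS : (1 - 1 / m) * c * ∑ i, (price m N (k i) : ℝ) ≤ R * ∑ i ∈ S, (price m N (k i) : ℝ)) :
    ∃ i ∈ S, k i < N := by
  by_contra! h
  have h0 : ∑ i ∈ S, (price m N (k i) : ℝ) = 0 := sum_eq_zero fun i hi => by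
    rw [price, if_neg (not_lt.2 (h i hi)), Rat.cast_zero]
  rw [h0, mul_zero] at hS
  obtain ⟨i, hi⟩ := card_pos.1 hact
  have hi' : k i < N := (mem_filter.1 hi).2
  have hY : 0 < ∑ i, (price m N (k i) : ℝ) :=
    sum_pos' (fun i _ => by exact_mod_cast price_nonneg hm N (k i))
      ⟨i, mem_univ i, by exact_mod_cast (price_pos_iff hm).2 hi'⟩
  have hq : (0 : ℝ) < 1 - 1 / m := price_base_pos_real hm
  have := mul_pos (mul_pos hq hc) hY
  linarith

theorem CostBounds.update {L : ℕ} {R Γ Γ' c : ℝ} (h : CostBounds m N R Γ k) (hm : 16 ≤ m)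
    (hN : N = m * m * L) (hL : m ≤ 2 ^ L) (hR : 0 < R) (hn : 0 < n) (hc : 0 < c) (hc1 : c ≤ 1)
    {S : Finset (Fin n)} {w : ℕ} (hw : w = if n < m * numActive N k then 1 else N)
    (hact : 0 < numActive N k)
    (hS : (1 - 1 / m) * c * ∑ i, (price m N (k i) : ℝ) ≤ R * ∑ i ∈ S, (price m N (k i) : ℝ))
    (hk : ∀ i, k' i = k i + w * if i ∈ S then 1 else 0) (hΓ : Γ' ≤ Γ + w * c) :
    CostBounds m N R Γ' k' := by
  have hm' : (0 : ℝ) < m := by exact_mod_cast (by omega : 0 < m)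
  have hq : (0 : ℝ) < 1 - 1 / m := price_base_pos_real (by omega)
  split_ifs at hw with hmany
  · subst hw
    have hpot := h.many hmany
    have hG := cost_le_of_active hm hN hL hR hn hmany hpot
    rw [Nat.cast_one, one_mul] at hΓ
    refine ⟨fun _ => ?_, fun hfew => ?_⟩
    · have h1 := sum_price_le (m := m) (N := N) (by omega) S
        (fun i => by rw [hk i, one_mul] : ∀ i, k' i = k i + if i ∈ S then 1 else 0)
      obtain ⟨Y, hY⟩ : ∃ Y, ∑ i, (price m N (k i) : ℝ) = Y := ⟨_, rfl⟩
      obtain ⟨P, hP⟩ : ∃ P, ∑ i ∈ S, (price m N (k i) : ℝ) = P := ⟨_, rfl⟩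
      rw [hY] at hpot h1 hS
      rw [hP] at h1 hS
      have hY0 : 0 ≤ Y := hY ▸ sum_nonneg fun i _ => by
        exact_mod_cast price_nonneg (by omega) N (k i)
      obtain ⟨α, hα⟩ : ∃ α : ℝ, 1 / m * (1 - 1 / m) / R = α := ⟨_, rfl⟩
      rw [hα] at hpot ⊢
      have hα0 : 0 < α := hα ▸ by positivity
      have h2 : α * c * Y ≤ 1 / m * P := by
        rw [← hα]
        calc 1 / (m : ℝ) * (1 - 1 / m) / R * c * Y
            = 1 / m * ((1 - 1 / m) * c * Y / R) := by ring
          _ ≤ 1 / m * P := by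
            gcongr
            rw [div_le_iff₀ hR]
            linarith
      calc ∑ i, (price m N (k' i) : ℝ) ≤ Y * (1 - α * c) := by linarith
        _ ≤ Y * Real.exp (-(α * c)) := by
          gcongr
          linarith [Real.add_one_le_exp (-(α * c))]
        _ ≤ n * Real.exp (-α * Γ) * Real.exp (-(α * c)) := by gcongr
        _ = n * Real.exp (-α * (Γ + c)) := by rw [mul_assoc, ← Real.exp_add]; ring_nf
        _ ≤ n * Real.exp (-α * Γ') := by
          gcongr ?_ * Real.exp ?_
          nlinarith
    · have h1 : (numActive N k' : ℝ) ≤ n / m := by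
        rw [le_div_iff₀ hm', mul_comm]
        exact_mod_cast hfew
      have h2 : (N : ℝ) * numActive N k' ≤ N * (n / m) := by gcongr
      linarith
  · subst hw
    have hlt : numActive w k' < numActive w k := by
      obtain ⟨i, hiS, hi⟩ := exists_active (by omega) hc hact hS
      refine card_lt_card ⟨fun j hj => ?_, fun hsub => ?_⟩
      · rw [mem_filter] at hj ⊢
        have := hk j
        exact ⟨mem_univ j, by omega⟩
      · have h1 : i ∈ ({i | k' i < w} : Finset (Fin n)) :=
          hsub (mem_filter.2 ⟨mem_univ i, hi⟩)
        have h2 := (mem_filter.1 h1).2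
        rw [hk i, if_pos hiS] at h2
        omega
    have hle : m * numActive w k' ≤ m * numActive w k := by gcongr
    refine ⟨fun hmany' => absurd hmany' (by omega), fun _ => ?_⟩
    have h1 := h.few (by omega)
    have h2 : (numActive w k' : ℝ) + 1 ≤ numActive w k := by exact_mod_cast hlt
    have h3 : (w : ℝ) * c ≤ w * 1 := by gcongr
    have h4 : (w : ℝ) * (numActive w k' + 1) ≤ w * numActive w k := by gcongr
    linarith

/-- The quantity that bounds the number of rounds increases. -/
theorem sum_min_lt {S : Finset (Fin n)} {w : ℕ} (hw : 0 < w) (hS : ∃ i ∈ S, k i < N)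
    (hk : ∀ i, k' i = k i + w * if i ∈ S then 1 else 0) :
    ∑ i, min (k i) N < ∑ i, min (k' i) N := by
  obtain ⟨i, hiS, hi⟩ := hS
  refine sum_lt_sum (fun j _ => ?_) ⟨i, mem_univ i, ?_⟩
  · have := hk j
    exact min_le_min_right _ (by omega)
  · rw [hk i, if_pos hiS]
    omega

end Potential

/-! ### One round of the price update -/

/-- Copies the chosen set to the entering column, and updates the numbers `k i` of times that the
elements have been covered, the prices and the number of active elements. -/
def updateLoop : Program :=
  forLoop nI (.var nSize)
    (.setReal rCol (.var nI) (.ofNat (.get nSets (.var nSize * .var nSize + .var nI))) ;;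
      .setNat nCount (.var nI) (.get nCount (.var nI) +
        .var nWeight * .get nSets (.var nSize * .var nSize + .var nI)) ;;
      .ite (.natLt (.get nCount (.var nI)) (.var nScale))
        (.setReal rPrice (.var nI) (.get rPrice (.var nI) *
            (1 - .get rCol (.var nI) / .ofNat (.var nDenom))) ;;
          .setNat nActive 0 (.var nActive + 1))
        (.setReal rPrice (.var nI) 0))

theorem halts_updateLoop {s : State} (hn : s.nat nSize 0 = n) (hact : s.nat nActive 0 = 0)
    (k : ℕ → ℕ) (hk : ∀ i, k i = s.nat nCount i + s.nat nWeight 0 * s.nat nSets (n * n + i)) :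
    Halts O updateLoop s ((n + 1) * 130) fun s₁ =>
      (∀ i < n, s₁.real rCol i = s.nat nSets (n * n + i)) ∧ (∀ i < n, s₁.nat nCount i = k i) ∧
      (∀ i < n, s₁.real rPrice i = if k i < s.nat nScale 0 then
        s.real rPrice i * (1 - s.nat nSets (n * n + i) / s.nat nDenom 0) else 0) ∧
      s₁.nat nActive 0 = ∑ i ∈ range n, if k i < s.nat nScale 0 then 1 else 0 := by
  refine (Halts.forLoop (N := n) (t := (100 : ℕ))
    (fun K s₁ => (∀ i < K, s₁.real rCol i = s.nat nSets (n * n + i)) ∧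
      (∀ i, s₁.nat nCount i = if i < K then k i else s.nat nCount i) ∧
      (∀ i, s₁.real rPrice i = if i < K then if k i < s.nat nScale 0 then
        s.real rPrice i * (1 - s.nat nSets (n * n + i) / s.nat nDenom 0) else 0
        else s.real rPrice i) ∧
      s₁.nat nActive 0 = ∑ i ∈ range K, if k i < s.nat nScale 0 then 1 else 0)
    (by positivity) (by decide) (by rfl) ?_ ?_ ?_).mono ?_ ?_
  · intro s₁ hf
    simp [hf.nat nSize rfl, hn]
  · simp [hact]
  · rintro K hK s₁ hf hK' ⟨hcol, hcount, hprice, hact⟩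
    have hn₁ : s₁.nat nSize 0 = n := by rw [hf.nat nSize rfl, hn]
    have hsets : s₁.nat nSets = s.nat nSets := hf.nat nSets rfl
    have hw : s₁.nat nWeight = s.nat nWeight := hf.nat nWeight rfl
    have hN : s₁.nat nScale = s.nat nScale := hf.nat nScale rfl
    have hm : s₁.nat nDenom = s.nat nDenom := hf.nat nDenom rfl
    have hcK : s₁.nat nCount K = s.nat nCount K := by simp [hcount]
    have hpK : s₁.real rPrice K = s.real rPrice K := by simp [hprice]
    have hcases : ∀ i, i < K + 1 ↔ i = K ∨ i < K := fun i => by omega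
    refine Halts.of_straight rfl (by decide) ?_
    by_cases h : k K < s.nat nScale 0
    all_goals
      have h' := h
      rw [hk] at h'
      simp only [Program.exec, State.putReal_nat, State.putNat_real, State.putNat_nat,
        State.putReal_real, NExpr.eval_var, NExpr.eval_get, NExpr.eval_add, NExpr.eval_mul,
        BExpr.holds_natLt, RExpr.eval_mul, RExpr.eval_sub, RExpr.eval_div, RExpr.eval_get,
        RExpr.eval_ofNat, RExpr.eval_lit, NExpr.eval_lit, hn₁, hsets, hw, hN, hm, hK', hcK, hpK,
        h', true_and, if_true, if_false, Nat.reduceEqDiff, false_and, and_self, and_true,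
        sum_range_succ, h]
      refine ⟨fun i hi => ?_, fun i => ?_, fun i => ?_, ?_⟩
      · rcases (hcases i).1 hi with rfl | hi
        · simp
        · simp [hi.ne, hcol i hi]
      · by_cases hi : i = K
        · simp [hi, hk]
        · simp [hi, hcount, hcases]
      · by_cases hi : i = K
        · simp [hi, h]
        · simp [hi, hprice, hcases]
      · simp [hact]
  · push_cast
    linarith
  · rintro s₁ - ⟨h1, h2, h3, h4⟩
    exact ⟨h1, fun i hi => by rw [h2, if_pos hi], fun i hi => by rw [h3, if_pos hi], h4⟩

theorem Tableau.congr {s s₁ : State} {col : ℕ → I.Col ⊕ Fin n} {b : Fin n → ℝ}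
    (hT : Tableau I s col b) (hn : s₁.nat nSize 0 = s.nat nSize 0)
    (hval : ∀ j < n, s₁.real rVal j = s.real rVal j)
    (hcost : ∀ j < n, s₁.real rCost j = s.real rCost j) (hinv : s₁.real rInv = s.real rInv)
    (hsets : ∀ l < n * n, s₁.nat nSets l = s.nat nSets l) : Tableau I s₁ col b where
  size := hn.trans hT.size
  val_nonneg j hj := by rw [hval j hj]; exact hT.val_nonneg j hj
  cost_eq j hj := by rw [hcost j hj]; exact hT.cost_eq j hj
  sets j hj S hS i := by
    rw [hsets _ (by nlinarith [i.2, Nat.mul_le_mul_right n (Nat.succ_le_of_lt hj)])]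
    exact hT.sets j hj S hS i
  inverse i k := by rw [hinv]; exact hT.inverse i k
  row_zero k hk := by rw [hinv]; exact hT.row_zero k hk
  balance i := by
    rw [← hT.balance i]
    exact sum_congr rfl fun j hj => by rw [hval j (mem_range.1 hj)]

theorem totalCost_congr {s s₁ : State} (hval : ∀ j < n, s₁.real rVal j = s.real rVal j)
    (hcost : ∀ j < n, s₁.real rCost j = s.real rCost j) : totalCost n s₁ = totalCost n s :=
  sum_congr rfl fun j hj => by rw [hval j (mem_range.1 hj), hcost j (mem_range.1 hj)]

/-- Weight `1` while more than `n / m` elements are active, and weight `N` otherwise. -/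
def chooseWeight : Program :=
  .ite (.natLt (.var nSize) (.var nDenom * .var nActive))
      (.setNat nWeight 0 1) (.setNat nWeight 0 (.var nScale)) ;;
    .setNat nActive 0 0

/-- One round: buy a nearly densest set, with weight `1` or, if few elements are active, with
weight `N`. -/
def round : Program :=
  .separate rPrice 0 (1 / .ofNat (.var nDenom)) nSets (.var nSize * .var nSize) ;;
    .evalCost nSets (.var nSize * .var nSize) rCost (.var nSize) ;;
    chooseWeight ;; updateLoop ;; .setReal rVal (.var nSize) (.ofNat (.var nWeight)) ;; enter

/-- The invariant of the main loop; at most `r` more rounds follow. -/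
structure MainInv (I : CoverInstance n) (m N r : ℕ) (s : State) : Prop where
  tableau : ∃ col, Tableau I s col fun i => s.nat nCount i
  denom : s.nat nDenom 0 = m
  scale : s.nat nScale 0 = N
  price : ∀ i : Fin n, s.real rPrice i = price m N (s.nat nCount i)
  active : s.nat nActive 0 = numActive N fun i : Fin n => s.nat nCount i
  bounds : CostBounds m N I.optF (totalCost n s) fun i : Fin n => s.nat nCount i
  rounds : n * N ≤ ∑ i : Fin n, min (s.nat nCount i) N + r

/-- Multiplying by `1 - h / m` is also right for weight `N`, as the price is then zero unless
`h = 0`. -/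
theorem price_add {m N k w h : ℕ} (hw : w = 1 ∨ w = N) (hh : h = 0 ∨ h = 1) :
    (if k + w * h < N then (price m N k : ℝ) * (1 - h / m) else 0) = price m N (k + w * h) := by
  unfold price
  rcases hh with rfl | rfl
  · split_ifs <;> simp_all
  · rcases hw with rfl | rfl
    · simp only [mul_one]
      split_ifs with h1 h2
      · push_cast
        rw [pow_succ]
      · omega
      · simp
    · simp

/-- A round takes the time of the two subroutine calls and `O(n²)` further steps. -/
theorem halts_round {m N L r : ℕ} {s : State} (hsep : I.IsDualSeparation O.sep)
    (hfeas : ∃ z, I.IsFeasible z) (hn : 0 < n) (hm : 16 ≤ m) (hN : N = m * m * L)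
    (hL : m ≤ 2 ^ L) (h : MainInv I m N r s) (hact : 0 < s.nat nActive 0) :
    Halts O round s ((n + 2) * ((n + 2) * 1000) + O.costTime + O.sepTime (1 / m))
      fun s₁ => ∃ r₁ < r, MainInv I m N r₁ s₁ := by
  have hm0 : (16 : ℚ) ≤ m := by exact_mod_cast hm
  have hN0 : 0 < N := by
    have : L ≠ 0 := by
      rintro rfl
      omega
    rw [hN]
    positivity
  obtain ⟨col, hT⟩ := h.tableau
  have hε0 : (0 : ℚ) < 1 / m := by positivity
  have hε1 : (1 : ℚ) / m < 1 := by rw [div_lt_one] <;> linarith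
  obtain ⟨y, hy⟩ : ∃ y : Fin n → ℚ, ∀ i, y i = RAM.price m N (s.nat nCount i) := ⟨_, fun _ => rfl⟩
  have hy0 : ∀ i, 0 ≤ y i := fun i => hy i ▸ price_nonneg (by omega) N _
  obtain ⟨S, hS⟩ : ∃ S, O.sep y (1 / m) = S := ⟨_, rfl⟩
  have hdense := hsep.mul_sum_le hfeas hy0 hε0 hε1
  simp only [hS, hy] at hdense
  push_cast at hdense
  have hn1 : (1 : ℝ) ≤ n := by exact_mod_cast hn
  -- The subroutine calls.
  refine Halts.seq_le (t₁ := 20 + n + O.sepTime (1 / m))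
    (t₂ := (n + 2) * ((n + 2) * 980) + O.costTime)
    (fun s₁ => s₁ = s.putSet nSets (n * n) S.1) ⟨_, _, Run.separate y (1 / m) ?_ hy0 ?_ hε0 hε1,
      ?_, by simp [← hS, hT.size]⟩ ?_ (by nlinarith)
  · intro i
    simp [h.price, hy]
  · simp [h.denom]
  · have h1 : (0 : NExpr).time = 1 := rfl
    have h2 : (1 / .ofNat (.var nDenom) : RExpr).time = 6 := rfl
    have h3 : (.var nSize * .var nSize : NExpr).time = 5 := rfl
    rw [h1, h2, h3]
    push_cast
    linarith
  intro s₁ f₁ hs₁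
  have hn₁ : s₁.nat nSize 0 = n := by rw [f₁.nat nSize rfl, hT.size]
  have hset₁ : s₁.HoldsSet nSets (n * n) S.1 := hs₁ ▸ State.holdsSet_putSet _ _ _ _
  have hsets₁ : ∀ l < n * n, s₁.nat nSets l = s.nat nSets l := fun l hl => by
    rw [hs₁, State.putSet_nat_of_lt _ _ _ _ _ hl]
  refine Halts.seq_le (t₁ := 20 + n + O.costTime) (t₂ := (n + 2) * ((n + 2) * 950))
    (fun s₂ => ∀ j, s₂.real rCost j = if j = n then I.cost S else s.real rCost j)
    ⟨_, _, Run.evalCost S (by simpa [hn₁] using hset₁), ?_, ?_⟩ ?_ (by nlinarith)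
  · have h2 : (.var nSize : NExpr).time = 2 := rfl
    have h3 : (.var nSize * .var nSize : NExpr).time = 5 := rfl
    rw [h2, h3]
    push_cast
    linarith
  · simp [hn₁, f₁.real rCost rfl]
  intro s₂ f₂ hcost₂
  have hn₂ : s₂.nat nSize 0 = n := by rw [f₂.nat nSize rfl, hn₁]
  have hset₂ : s₂.HoldsSet nSets (n * n) S.1 := fun i => by rw [f₂.nat nSets rfl, hset₁ i]
  obtain ⟨w, hw⟩ :
      ∃ w, w = if n < m * numActive N (fun i : Fin n => s.nat nCount i) then 1 else N :=
    ⟨_, rfl⟩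
  have hw0 : 0 < w := by rw [hw]; split_ifs <;> omega
  have hw' : w = 1 ∨ w = N := by rw [hw]; split_ifs <;> simp
  refine Halts.seq_le (t₁ := (40 : ℕ)) (t₂ := (n + 2) * ((n + 2) * 900))
    (fun s₃ => s₃.nat nWeight 0 = w ∧ s₃.nat nActive 0 = 0)
    (Halts.of_straight rfl (by decide) ?_) ?_ (by push_cast; nlinarith)
  · simp only [Program.exec, chooseWeight, BExpr.holds_natLt, NExpr.eval_var, NExpr.eval_mul, hn₂,
      f₂.nat nDenom rfl, f₁.nat nDenom rfl, h.denom, f₂.nat nActive rfl, f₁.nat nActive rfl,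
      h.active, hw]
    split_ifs <;> simp [f₂.nat nScale rfl, f₁.nat nScale rfl, h.scale]
  rintro s₃ f₃ ⟨hw₃, hact₃⟩
  have hn₃ : s₃.nat nSize 0 = n := by rw [f₃.nat nSize rfl, hn₂]
  have hset₃ : s₃.HoldsSet nSets (n * n) S.1 := fun i => by rw [f₃.nat nSets rfl, hset₂ i]
  refine Halts.seq_le (t₂ := (n + 2) * ((n + 2) * 830)) _
    (halts_updateLoop hn₃ hact₃ _ fun _ => rfl) ?_ (by nlinarith)
  rintro s₄ f₄ ⟨hcol₄, hcount₄, hprice₄, hact₄⟩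
  have hn₄ : s₄.nat nSize 0 = n := by rw [f₄.nat nSize rfl, hn₃]
  have hcount : ∀ i : Fin n,
      s₄.nat nCount i = s.nat nCount i + w * if i ∈ S.1 then 1 else 0 := fun i => by
    rw [hcount₄ i i.2, hset₃ i, hw₃, f₃.nat nCount rfl, f₂.nat nCount rfl, f₁.nat nCount rfl]
  refine Halts.seq_le (t₁ := (10 : ℕ)) (t₂ := (n + 2) * ((n + 2) * 800))
    (fun s₅ => ∀ j, s₅.real rVal j = if j = n then (w : ℝ) else s.real rVal j)
    (Halts.of_straight rfl (by decide) ?_) ?_ (by push_cast; nlinarith)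
  · simp [Program.exec, hn₄, f₄.nat nWeight rfl, hw₃, f₄.real rVal rfl, f₃.real rVal rfl,
      f₂.real rVal rfl, f₁.real rVal rfl]
  intro s₅ f₅ hval₅
  have hcost₅ : ∀ j, s₅.real rCost j = if j = n then I.cost S else s.real rCost j := fun j => by
    rw [f₅.real rCost rfl, f₄.real rCost rfl, f₃.real rCost rfl, hcost₂]
  have hval : ∀ j < n, s₅.real rVal j = s.real rVal j := fun j hj => by
    rw [hval₅, if_neg hj.ne]
  have hcost : ∀ j < n, s₅.real rCost j = s.real rCost j := fun j hj => by
    rw [hcost₅, if_neg hj.ne]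
  have hset₅ : s₅.HoldsSet nSets (n * n) S.1 := fun i => by
    rw [f₅.nat nSets rfl, f₄.nat nSets rfl, hset₃ i]
  have hT₅ : Tableau I s₅ col fun i => s.nat nCount i := by
    refine hT.congr ?_ hval hcost ?_ ?_
    · rw [f₅.nat nSize rfl, hn₄, hT.size]
    · rw [f₅.real rInv rfl, f₄.real rInv rfl, f₃.real rInv rfl, f₂.real rInv rfl,
        f₁.real rInv rfl]
    · intro l hl
      rw [f₅.nat nSets rfl, f₄.nat nSets rfl, f₃.nat nSets rfl, f₂.nat nSets rfl, hsets₁ l hl]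
  refine (halts_enter hT₅ (.inl S) ?_ ?_ ?_ ?_).mono le_rfl ?_
  · intro i
    rw [f₅.real rCol rfl, hcol₄ i i.2, hset₃ i]
    simp [CoverInstance.colVec, CoverInstance.charVec]
  · simp [hcost₅, CoverInstance.colCost]
  · simp [hval₅]
  · rintro S' hS'
    rw [← Sum.inl.inj hS']
    exact hset₅
  rintro s₆ f₆ ⟨⟨col', hT₆⟩, htot⟩
  have hcount₆ : ∀ i : Fin n,
      s₆.nat nCount i = s.nat nCount i + w * if i ∈ S.1 then 1 else 0 := fun i => by
    rw [f₆.nat nCount rfl, f₅.nat nCount rfl, hcount]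
  have hact' : 0 < numActive N fun i : Fin n => s.nat nCount i := h.active ▸ hact
  have hlt := sum_min_lt hw0
    (exists_active (by omega) (I.cost_pos S) hact' hdense) hcount₆
  have hr := h.rounds
  have hle : ∑ i : Fin n, min (s₆.nat nCount i) N ≤ n * N :=
    (sum_le_card_nsmul univ _ N fun i _ => min_le_right _ _).trans (by simp)
  refine ⟨r - 1, by omega, ⟨col', ?_⟩, ?_, ?_, ?_, ?_, ?_, ?_⟩
  · convert hT₆ using 2 with i
    rw [hcount₆ i, hval₅, if_pos rfl]
    simp [CoverInstance.colVec, CoverInstance.charVec]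
  · rw [f₆.nat nDenom rfl, f₅.nat nDenom rfl, f₄.nat nDenom rfl, f₃.nat nDenom rfl,
      f₂.nat nDenom rfl, f₁.nat nDenom rfl, h.denom]
  · rw [f₆.nat nScale rfl, f₅.nat nScale rfl, f₄.nat nScale rfl, f₃.nat nScale rfl,
      f₂.nat nScale rfl, f₁.nat nScale rfl, h.scale]
  · intro i
    rw [f₆.real rPrice rfl, f₅.real rPrice rfl, hprice₄ i i.2, f₃.real rPrice rfl,
      f₂.real rPrice rfl, f₁.real rPrice rfl, h.price i, f₃.nat nScale rfl, f₂.nat nScale rfl,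
      f₁.nat nScale rfl, h.scale, f₃.nat nDenom rfl, f₂.nat nDenom rfl, f₁.nat nDenom rfl, h.denom,
      hcount₆ i, ← price_add hw' (by split_ifs <;> simp), f₃.nat nCount rfl, f₂.nat nCount rfl,
      f₁.nat nCount rfl, hw₃, hset₃ i]
  · rw [f₆.nat nActive rfl, f₅.nat nActive rfl, hact₄, Finset.sum_range, numActive, card_filter,
      f₃.nat nScale rfl, f₂.nat nScale rfl, f₁.nat nScale rfl, h.scale]
    refine sum_congr rfl fun i _ => ?_
    rw [hcount₆ i, f₃.nat nCount rfl, f₂.nat nCount rfl,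
      f₁.nat nCount rfl, hw₃, hset₃ i]
  · refine h.bounds.update hm hN hL (hsep.optF_pos hfeas hn) hn (I.cost_pos S) (I.cost_le_one S) hw
      hact' hdense hcount₆ ?_
    rw [totalCost_congr hval hcost, hval₅, if_pos rfl] at htot
    exact htot
  · omega

/-! ### Initialization -/

/-- Computes the denominator `m = ⌈8 n / δ⌉` by counting, as real numbers cannot be rounded. -/
def denomLoop : Program :=
  .while (.realLt (.ofNat (.var nDenom) * .var rOut) (8 * .ofNat (.var nSize)))
    (.setNat nDenom 0 (.var nDenom + 1))

theorem halts_denomLoop {δ : ℝ} (hδ : 0 < δ) {s : State} (hn : s.nat nSize 0 = n)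
    (hr : s.real rOut 0 = δ) (hm : s.nat nDenom 0 = 0) {m : ℕ} (hM : m = ⌈8 * (n : ℝ) / δ⌉₊) :
    Halts O denomLoop s ((m + 1) * 30) fun s₁ => s₁.nat nDenom 0 = m := by
  refine (Halts.whileLoop (t := (10 : ℕ)) (fun k s₁ => s₁.nat nSize 0 = n ∧ s₁.real rOut 0 = δ ∧
    s₁.nat nDenom 0 + k = m) (by positivity) ?_ m s ⟨hn, hr, by rw [hm, zero_add]⟩).mono ?_ ?_
  · rintro k s₁ ⟨hn, hr, hk⟩ hb
    have hlt : s₁.nat nDenom 0 < m := by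
      rw [hM, Nat.lt_ceil, lt_div_iff₀ hδ]
      simpa [hn, hr] using hb
    refine Halts.of_straight rfl (by decide) ⟨k - 1, by omega, ?_⟩
    simp [Program.exec, hn, hr]
    omega
  · have h : (BExpr.realLt (.ofNat (.var nDenom) * .var rOut) (8 * .ofNat (.var nSize))).time =
      13 := rfl
    rw [h]
    push_cast
    linarith [(Nat.cast_nonneg m : (0 : ℝ) ≤ m)]
  · rintro s₁ - ⟨⟨k, -, hn, hr, hk⟩, hb⟩
    refine le_antisymm (by omega) ?_
    rw [hM, Nat.ceil_le, div_le_iff₀ hδ]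
    simpa [hn, hr] using hb

/-- Computes the least `L` with `m ≤ 2 ^ L`. -/
def logLoop : Program :=
  .setNat nPow 0 1 ;;
    .while (.natLt (.var nPow) (.var nDenom))
      (.setNat nPow 0 (2 * .var nPow) ;; .setNat nLog 0 (.var nLog + 1))

theorem halts_logLoop {s : State} (hL : s.nat nLog 0 = 0) {m : ℕ} (hm : s.nat nDenom 0 = m) :
    Halts O logLoop s ((Nat.clog 2 m + 1) * 50) fun s₁ => s₁.nat nLog 0 = Nat.clog 2 m := by
  refine Halts.seq_le (t₁ := (10 : ℕ)) (t₂ := (Nat.clog 2 m + 1) * 40)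
    (fun s₁ => s₁.nat nPow 0 = 1) (Halts.of_straight rfl (by decide) (by simp [Program.exec])) ?_ ?_
  · intro s₁ f₁ h₁
    refine (Halts.whileLoop (t := (20 : ℕ)) (fun k s₂ => s₂.nat nDenom 0 = m ∧
      s₂.nat nPow 0 = 2 ^ s₂.nat nLog 0 ∧ s₂.nat nLog 0 + k = Nat.clog 2 m) (by positivity) ?_
      (Nat.clog 2 m) s₁ ?_).mono ?_ ?_
    · rintro k s₂ ⟨hm, hp, hk⟩ hb
      have hlt : s₂.nat nLog 0 < Nat.clog 2 m := by
        rw [Nat.lt_clog_iff_pow_lt (by norm_num), ← hp]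
        simpa [hm] using hb
      refine Halts.of_straight rfl (by decide) ⟨k - 1, by omega, ?_⟩
      simp [Program.exec, hm, hp, pow_succ, mul_comm]
      omega
    · simp [f₁.nat nDenom rfl, f₁.nat nLog rfl, hm, h₁, hL]
    · have h : (BExpr.natLt (.var nPow) (.var nDenom)).time = 5 := rfl
      rw [h]
      push_cast
      linarith [(Nat.cast_nonneg (Nat.clog 2 m) : (0 : ℝ) ≤ _)]
    · rintro s₂ - ⟨⟨k, -, hm, hp, hk⟩, hb⟩
      refine le_antisymm (by omega) ?_
      rw [Nat.clog_le_iff_le_pow (by norm_num), ← hp]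
      simpa [hm] using hb
  · push_cast
    linarith [(Nat.cast_nonneg (Nat.clog 2 m) : (0 : ℝ) ≤ _)]

/-- Computes `N`, and starts with the prices `1` and the basis of the slack variables. -/
def basisLoop : Program :=
  .setNat nScale 0 (.var nDenom * .var nDenom * .var nLog) ;;
    .setNat nActive 0 (.var nSize) ;;
    forLoop nI (.var nSize)
      (.setReal rPrice (.var nI) 1 ;;
        .setReal rInv (.var nI * .var nSize + .var nI) (0 - 1))

/-- Computes the parameters and the initial basis. -/
def setup : Program := denomLoop ;; logLoop ;; basisLoop

theorem halts_setup {δ : ℝ} (hδ : 0 < δ) (hδn : δ ≤ (n : ℝ) / 2) {m L N : ℕ}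
    (hM : m = ⌈8 * (n : ℝ) / δ⌉₊) (hL : L = Nat.clog 2 m) (hN : N = m * m * L) (hN0 : 0 < N)
    (hm : 16 ≤ m) :
    Halts O setup (initState n δ) ((m + L + n + 3) * 200) fun s₁ => MainInv I m N (n * N) s₁ := by
  have hn : 0 < n := by
    rcases Nat.eq_zero_or_pos n with rfl | h
    · simp at hδn; linarith
    · exact h
  have hm0 : (0 : ℝ) ≤ m := Nat.cast_nonneg m
  have hL0 : (0 : ℝ) ≤ L := Nat.cast_nonneg L
  have hn0 : (0 : ℝ) ≤ n := Nat.cast_nonneg n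
  obtain ⟨s, hs⟩ : ∃ s, initState n δ = s := ⟨_, rfl⟩
  have hnat : ∀ a, a ≠ 0 → s.nat a = fun _ => 0 := by
    intro a ha
    rw [← hs, initState, State.putReal_nat, State.putNat_nat_of_ne _ _ _ _ _ ha]
  have hreal : ∀ a, a ≠ 0 → s.real a = fun _ => 0 := by
    intro a ha
    rw [← hs, initState, State.putReal_real_of_ne _ _ _ _ _ ha, State.putNat_real]
  have hn' : s.nat nSize 0 = n := by simp [← hs, initState]
  have hδ' : s.real rOut 0 = δ := by simp [← hs, initState]
  rw [hs]
  refine Halts.seq_le (t₂ := (L + n + 2) * 150) _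
    (halts_denomLoop hδ hn' hδ' (by simp [hnat]) hM) ?_ (by linarith)
  intro s₁ f₁ h₁
  refine Halts.seq_le (t₂ := (n + 1) * 100) _
    (halts_logLoop (by simp [f₁.nat nLog rfl, hnat]) h₁) ?_ (by rw [← hL]; linarith)
  intro s₂ f₂ h₂
  have hm₂ : s₂.nat nDenom 0 = m := by rw [f₂.nat nDenom rfl, h₁]
  have hn₂ : s₂.nat nSize 0 = n := by rw [f₂.nat nSize rfl, f₁.nat nSize rfl, hn']
  refine Halts.seq_le (t₁ := (20 : ℕ)) (t₂ := (n + 1) * 80) (fun s₃ => s₃.nat nScale 0 = N)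
    (Halts.of_straight rfl (by decide) (by simp [Program.exec, hm₂, h₂, hN, hL])) ?_
    (by push_cast; linarith)
  intro s₃ f₃ hN₃
  have hn₃ : s₃.nat nSize 0 = n := by rw [f₃.nat nSize rfl, hn₂]
  refine Halts.seq_le (t₁ := (10 : ℕ)) (t₂ := (n + 1) * 60) (fun s₄ => s₄.nat nActive 0 = n)
    (Halts.of_straight rfl (by decide) (by simp [Program.exec, hn₃])) ?_
    (by push_cast; linarith)
  intro s₄ f₄ hact₄
  have hn₄ : s₄.nat nSize 0 = n := by rw [f₄.nat nSize rfl, hn₃]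
  refine (Halts.forLoop (N := n) (t := (30 : ℕ))
    (fun K s₅ => (∀ i < K, s₅.real rPrice i = 1) ∧
      ∀ j, ∀ k < n, s₅.real rInv (j * n + k) = if j < K ∧ j = k then -1 else 0)
    (by positivity) (by decide) (by rfl) (fun s₅ f₅ => by simp [f₅.nat nSize rfl, hn₄]) ?_ ?_).mono
    ?_ ?_
  · simp [f₄.real rInv rfl, f₃.real rInv rfl, f₂.real rInv rfl, f₁.real rInv rfl, hreal]
  · rintro K hK s₅ f₅ hK' ⟨hp, hinv⟩
    have hn₅ : s₅.nat nSize 0 = n := by rw [f₅.nat nSize rfl, hn₄]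
    refine Halts.of_straight rfl (by decide) ⟨fun i hi => ?_, fun j k hk => ?_⟩
    · simp only [Program.exec, State.putNat_real, State.putReal_real, NExpr.eval_var, hK',
        RExpr.eval_lit, true_and, Nat.reduceEqDiff, false_and, if_false]
      rcases (by omega : i = K ∨ i < K) with rfl | h
      · simp
      · simp [h.ne, hp i h]
    · have h1 := hinv j k hk
      have h2 : j < K + 1 ∧ j = k ↔ (j = K ∧ k = K) ∨ (j < K ∧ j = k) := by omega
      simp only [Program.exec, State.putNat_real, State.putReal_real, NExpr.eval_var, hK',
        RExpr.eval_lit, true_and, RExpr.eval_sub, NExpr.eval_add, NExpr.eval_mul, hn₅,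
        State.putReal_nat, cell_inj hk hK, Nat.reduceEqDiff, false_and, if_false, h1, h2]
      by_cases h3 : j = K ∧ k = K
      · simp [h3]
      · simp [h3]
  · push_cast
    linarith
  rintro s₅ f₅ ⟨hp, hinv⟩
  have hnat₅ : s₅.nat nCount = fun _ => 0 := by
    rw [f₅.nat nCount rfl, f₄.nat nCount rfl, f₃.nat nCount rfl, f₂.nat nCount rfl,
      f₁.nat nCount rfl, hnat _ (by norm_num)]
  have hval₅ : s₅.real rVal = fun _ => 0 := by
    rw [f₅.real rVal rfl, f₄.real rVal rfl, f₃.real rVal rfl, f₂.real rVal rfl,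
      f₁.real rVal rfl, hreal _ (by norm_num)]
  have hcost₅ : s₅.real rCost = fun _ => 0 := by
    rw [f₅.real rCost rfl, f₄.real rCost rfl, f₃.real rCost rfl, f₂.real rCost rfl,
      f₁.real rCost rfl, hreal _ (by norm_num)]
  have hactive : numActive N (fun i : Fin n => s₅.nat nCount i) = n := by
    simp [numActive, hnat₅, hN0]
  refine ⟨⟨fun j => .inr ⟨min j (n - 1), by omega⟩, ?_, ?_, ?_, ?_, ?_, ?_, ?_⟩,
    ?_, ?_, ?_, ?_, ?_, ?_⟩
  · rw [f₅.nat nSize rfl, hn₄]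
  · simp [hval₅]
  · simp [hcost₅, CoverInstance.colCost]
  · simp
  · intro i k
    have hterm : ∀ j ∈ range n, I.colVec (.inr ⟨min j (n - 1), by omega⟩) i *
        s₅.real rInv (j * n + k) = if j = k then (if i = k then 1 else 0) else 0 := by
      intro j hj
      have hj' := mem_range.1 hj
      rw [hinv j k k.2]
      by_cases h : j = k
      · have h' : (⟨min j (n - 1), by omega⟩ : Fin n) = k := Fin.ext (by simp; omega)
        rw [if_pos ⟨hj', h⟩, if_pos h, h']
        simp [CoverInstance.colVec, Pi.single_apply]
      · rw [if_neg (fun h' => h h'.2), if_neg h, mul_zero]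
    rw [sum_congr rfl hterm, sum_ite_eq', if_pos (mem_range.2 k.2)]
  · intro k hk
    rw [hinv n k hk, if_neg (by omega)]
  · simp [hval₅, hnat₅]
  · rw [f₅.nat nDenom rfl, f₄.nat nDenom rfl, f₃.nat nDenom rfl, hm₂]
  · rw [f₅.nat nScale rfl, f₄.nat nScale rfl, hN₃]
  · intro i
    simp [hp i i.2, hnat₅, price, hN0]
  · rw [hactive, f₅.nat nActive rfl, hact₄]
  · refine ⟨fun _ => ?_, fun h => ?_⟩
    · simp [hnat₅, price, hN0, totalCost, hval₅]
    · rw [hactive] at h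
      nlinarith
  · omega

/-! ### Turning excess coverage into slack -/

/-- Lets the slack variable of each element `i` enter with the value `k i - N`. -/
def slackLoop : Program :=
  forLoop nE (.var nSize)
    (forLoop nI (.var nSize) (.setReal rCol (.var nI) 0) ;;
      (.setReal rCol (.var nE) (0 - 1) ;; .setReal rCost (.var nSize) 0 ;;
        .setReal rVal (.var nSize) (.ofNat (.get nCount (.var nE) - .var nScale))) ;; enter)

theorem halts_slackLoop {N : ℕ} {s : State} (hN : s.nat nScale 0 = N)
    (hcount : ∀ i < n, N ≤ s.nat nCount i)
    (hT : ∃ col, Tableau I s col fun i => s.nat nCount i) :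
    Halts O slackLoop s ((n + 2) * ((n + 2) * ((n + 2) * 1000))) fun s₁ =>
      (∃ col, Tableau I s₁ col fun _ => N) ∧ totalCost n s₁ ≤ totalCost n s := by
  have hn0 : (0 : ℝ) ≤ n := Nat.cast_nonneg n
  have hn : s.nat nSize 0 = n := by
    obtain ⟨col, hT⟩ := hT
    exact hT.size
  refine (Halts.forLoop (N := n) (t := (n + 2) * ((n + 2) * 900))
    (fun E s₁ => (∃ col, Tableau I s₁ col fun i => if (i : ℕ) < E then (N : ℝ)
      else s.nat nCount i) ∧ totalCost n s₁ ≤ totalCost n s)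
    (by positivity) (by decide) (by rfl) (fun s₁ f₁ => by simp [f₁.nat nSize rfl, hn]) ?_ ?_).mono
    ?_ ?_
  · obtain ⟨col, hT⟩ := hT
    exact ⟨⟨col, by simpa using hT.congr (by simp) (by simp) (by simp) (by simp) (by simp)⟩,
      (totalCost_congr (by simp) (by simp)).le⟩
  · rintro E hE s₁ f₁ hE₁ ⟨⟨col, hT₁⟩, htot₁⟩
    have hn₁ := hT₁.size
    refine Halts.seq_le (t₁ := (n + 1) * ((10 : ℕ) + 30)) (t₂ := (n + 2) * ((n + 2) * 840))
      (fun s₂ => ∀ i < n, s₂.real rCol i = 0) ?_ ?_ (by push_cast; nlinarith)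
    · refine Halts.forLoop (fun K s₂ => ∀ i < K, s₂.real rCol i = 0)
        (by positivity) (by decide) (by rfl) (fun s₂ f₂ => by simp [f₂.nat nSize rfl, hn₁])
        (by simp) ?_
      intro K hK s₂ f₂ hK₂ h₂
      refine Halts.of_straight rfl (by decide) fun i hi => ?_
      rcases (by omega : i = K ∨ i < K) with rfl | h
      · simp [Program.exec, hK₂]
      · simp [Program.exec, hK₂, h.ne, h₂ i h]
    intro s₂ f₂ h₂
    have hn₂ : s₂.nat nSize 0 = n := by rw [f₂.nat nSize rfl, hn₁]
    have hE₂ : s₂.nat nE 0 = E := by rw [f₂.nat nE rfl, hE₁]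
    refine Halts.seq_le (t₁ := (30 : ℕ)) (t₂ := (n + 2) * ((n + 2) * 800))
      (fun s₃ => (∀ i, s₃.real rCol i = if i = E then -1 else s₂.real rCol i) ∧
        (∀ j, s₃.real rCost j = if j = n then 0 else s₂.real rCost j) ∧
        ∀ j, s₃.real rVal j = if j = n then ((s.nat nCount E - N : ℕ) : ℝ) else s₂.real rVal j)
      (Halts.of_straight rfl (by decide) ?_) ?_ (by push_cast; nlinarith)
    · simp [Program.exec, hn₂, hE₂, f₂.nat nCount rfl, f₁.nat nCount rfl, f₂.nat nScale rfl,
        f₁.nat nScale rfl, hN]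
    rintro s₃ f₃ ⟨hcol₃, hcost₃, hval₃⟩
    have hval : ∀ j < n, s₃.real rVal j = s₁.real rVal j := fun j hj => by
      rw [hval₃, if_neg hj.ne, f₂.real rVal rfl]
    have hcost : ∀ j < n, s₃.real rCost j = s₁.real rCost j := fun j hj => by
      rw [hcost₃, if_neg hj.ne, f₂.real rCost rfl]
    have hT₃ := hT₁.congr (s₁ := s₃) (by rw [f₃.nat nSize rfl, f₂.nat nSize rfl]) hval hcost
      (by rw [f₃.real rInv rfl, f₂.real rInv rfl])
      (by simp [f₃.nat nSets rfl, f₂.nat nSets rfl])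
    refine (halts_enter hT₃ (.inr ⟨E, hE⟩) ?_ ?_ ?_ (by simp)).mono le_rfl ?_
    · intro i
      rw [hcol₃, h₂ i i.2]
      by_cases h : (i : ℕ) = E
      · have h' : i = ⟨E, hE⟩ := Fin.ext h
        simp [h', CoverInstance.colVec]
      · have h' : i ≠ ⟨E, hE⟩ := fun h' => h (congrArg Fin.val h')
        simp [h, h', CoverInstance.colVec]
    · simp [hcost₃, CoverInstance.colCost]
    · simp [hval₃]
    rintro s₄ f₄ ⟨⟨col', hT₄⟩, htot₄⟩
    rw [totalCost_congr hval hcost] at htot₄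
    simp only [CoverInstance.colCost, Sum.elim_inr, mul_zero, add_zero] at htot₄
    refine ⟨⟨col', ?_⟩, ?_⟩
    · have hT₅ := hT₄.congr (s₁ := s₄.putNat nE 0 (E + 1)) (by simp) (by simp) (by simp)
        (by simp) (by simp)
      convert hT₅ using 2 with i
      rw [hval₃, if_pos rfl, Nat.cast_sub (hcount E hE)]
      rcases lt_trichotomy (i : ℕ) E with h | h | h
      · have h' : i ≠ ⟨E, hE⟩ := fun h' => h.ne (congrArg Fin.val h')
        simp [h, h.trans (Nat.lt_succ_self E), CoverInstance.colVec, h']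
      · have h' : i = ⟨E, hE⟩ := Fin.ext h
        simp [h', CoverInstance.colVec]
      · have h' : i ≠ ⟨E, hE⟩ := fun h' => h.ne' (congrArg Fin.val h')
        simp [not_lt.2 h.le, show ¬ (i : ℕ) < E + 1 by omega, CoverInstance.colVec, h']
    · rw [totalCost_congr (s := s₄) (by simp) (by simp)]
      exact htot₄.trans htot₁
  · have : (n : ℝ) + 1 ≤ n + 2 := by linarith
    have h2 : (n + 2) * ((n + 2) * 900) + (30 : ℝ) ≤ (n + 2) * ((n + 2) * 1000) := by nlinarith
    gcongr
  · rintro s₁ - ⟨⟨col, hT₁⟩, htot₁⟩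
    refine ⟨⟨col, ?_⟩, htot₁⟩
    convert hT₁ using 2 with i
    rw [if_pos i.2]

/-! ### Output -/

/-- Lists the basic variables that belong to sets, which are those of positive cost. -/
def outputLoop : Program :=
  .setNat nActive 0 0 ;;
    forLoop nJ (.var nSize)
      (.ite (.realLt 0 (.get rCost (.var nJ)))
        (.setReal rOut (.var nActive) (.get rVal (.var nJ) / .ofNat (.var nScale)) ;;
          forLoop nI (.var nSize)
            (.setNat nOut (.var nActive * .var nSize + .var nI)
              (.get nSets (.var nJ * .var nSize + .var nI))) ;;
          .setNat nActive 0 (.var nActive + 1))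
        .skip) ;;
    .setNat nSize 0 (.var nActive)

theorem Tableau.cost_pos_iff {s : State} {col : ℕ → I.Col ⊕ Fin n} {b : Fin n → ℝ}
    (hT : Tableau I s col b) {j : ℕ} (hj : j < n) :
    0 < s.real rCost j ↔ ∃ S, col j = .inl S := by
  rw [hT.cost_eq j hj]
  cases col j with
  | inl S => simp [CoverInstance.colCost, I.cost_pos S]
  | inr i => simp [CoverInstance.colCost]

theorem Tableau.solution_eq {s : State} {col : ℕ → I.Col ⊕ Fin n} {b : Fin n → ℝ}
    (hT : Tableau I s col b) (N : ℝ) {j : ℕ} (hj : j < n) {S : I.Col} (hS : col j = .inl S) :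
    solution s col N S = s.real rVal j / N := by
  rw [solution, sum_eq_single j, if_pos hS]
  · intro j' hj' hne
    refine if_neg fun h => hne ?_
    exact congrArg Fin.val (hT.col_injective (a₁ := ⟨j', mem_range.1 hj'⟩) (a₂ := ⟨j, hj⟩)
      (h.trans hS.symm))
  · exact fun h => absurd (mem_range.2 hj) h

theorem halts_outputLoop {N : ℕ} {s : State} (hN : s.nat nScale 0 = N)
    {col : ℕ → I.Col ⊕ Fin n} {b : Fin n → ℝ} (hT : Tableau I s col b) :
    Halts O outputLoop s ((n + 2) * ((n + 2) * 200)) fun s₁ =>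
      Outputs I s₁ (solution s col N) := by
  have hn0 : (0 : ℝ) ≤ n := Nat.cast_nonneg n
  have hn := hT.size
  refine Halts.seq_le (t₁ := (10 : ℕ)) (t₂ := (n + 2) * ((n + 2) * 190))
    (fun s₁ => s₁.nat nActive 0 = 0) (Halts.of_straight rfl (by decide) (by simp [Program.exec]))
    ?_ (by push_cast; nlinarith)
  intro s₁ f₁ h₁
  have hn₁ : s₁.nat nSize 0 = n := by rw [f₁.nat nSize rfl, hn]
  -- `f q` is the slot of the `q`-th entry of the list.
  refine Halts.seq_le (t₁ := (n + 1) * (((n + 1) * 50 + 60) + 30)) (t₂ := (10 : ℕ))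
    (fun s₂ => ∃ f : ℕ → ℕ,
      (∀ q < s₂.nat nActive 0, f q < n ∧ s₂.real rOut q = s.real rVal (f q) / N ∧
        ∃ S, col (f q) = .inl S ∧ s₂.HoldsSet nOut (q * n) S.1) ∧
      (∀ q < s₂.nat nActive 0, ∀ q' < s₂.nat nActive 0, f q = f q' → q = q') ∧
      ∀ j < n, (∃ S, col j = .inl S) → ∃ q < s₂.nat nActive 0, f q = j) ?_ ?_
    (by push_cast; nlinarith)
  · refine (Halts.forLoop (N := n) (t := (n + 1) * 50 + 60) (fun J s₂ => ∃ f : ℕ → ℕ,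
      (∀ q < s₂.nat nActive 0, f q < J ∧ s₂.real rOut q = s.real rVal (f q) / N ∧
        ∃ S, col (f q) = .inl S ∧ s₂.HoldsSet nOut (q * n) S.1) ∧
      (∀ q < s₂.nat nActive 0, ∀ q' < s₂.nat nActive 0, f q = f q' → q = q') ∧
      ∀ j < J, (∃ S, col j = .inl S) → ∃ q < s₂.nat nActive 0, f q = j)
      (by positivity) (by decide) (by rfl) (fun s₂ f₂ => by simp [f₂.nat nSize rfl, hn₁]) ?_
      ?_).mono le_rfl fun _ _ => id
    · exact ⟨id, by simp [h₁]⟩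
    · rintro J hJ s₂ f₂ hJ₂ ⟨f, hf, hinj, hsurj⟩
      have hn₂ : s₂.nat nSize 0 = n := by rw [f₂.nat nSize rfl, hn₁]
      obtain ⟨c, hc⟩ : ∃ c, s₂.nat nActive 0 = c := ⟨_, rfl⟩
      rw [hc] at hf hinj hsurj
      have htest : (BExpr.realLt 0 (.get rCost (.var nJ))).Holds s₂ ↔ ∃ S, col J = .inl S := by
        rw [← hT.cost_pos_iff hJ]
        simp [hJ₂, f₂.real rCost rfl, f₁.real rCost rfl]
      have htime : (BExpr.realLt 0 (.get rCost (.var nJ))).time = 6 := rfl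
      refine (Halts.ite (t := (n + 1) * 50 + 50) ?_ ?_).time_le (by rw [htime]; push_cast; linarith)
      · rw [htest]
        rintro ⟨S, hS⟩
        refine Halts.seq_le (t₁ := (20 : ℕ)) (t₂ := (n + 1) * 50 + 30)
          (fun s₃ => ∀ q, s₃.real rOut q = if q = c then s.real rVal J / N else s₂.real rOut q)
          (Halts.of_straight rfl (by decide) ?_) ?_ (by push_cast; linarith)
        · simp [Program.exec, hc, hJ₂, f₂.real rVal rfl, f₁.real rVal rfl, f₂.nat nScale rfl,
            f₁.nat nScale rfl, hN]
        intro s₃ f₃ h₃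
        have hn₃ : s₃.nat nSize 0 = n := by rw [f₃.nat nSize rfl, hn₂]
        have hc₃ : s₃.nat nActive 0 = c := by rw [f₃.nat nActive rfl, hc]
        have hJ₃ : s₃.nat nJ 0 = J := by rw [f₃.nat nJ rfl, hJ₂]
        refine Halts.seq_le (t₁ := (n + 1) * ((20 : ℕ) + 30)) (t₂ := (20 : ℕ))
          (fun s₄ => ∀ q, ∀ k < n, s₄.nat nOut (q * n + k) =
            if q = c then s.nat nSets (J * n + k) else s₂.nat nOut (q * n + k)) ?_ ?_
          (by push_cast; linarith)
        · refine (Halts.forLoop (N := n) (t := (20 : ℕ))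
            (fun K s₄ => ∀ q, ∀ k < n, s₄.nat nOut (q * n + k) =
              if q = c ∧ k < K then s.nat nSets (J * n + k) else s₂.nat nOut (q * n + k))
            (by positivity) (by decide) (by rfl) (fun s₄ f₄ => by simp [f₄.nat nSize rfl, hn₃])
            ?_ ?_).mono le_rfl ?_
          · simp [f₃.nat nOut rfl]
          · intro K hK s₄ f₄ hK₄ h₄
            refine Halts.of_straight rfl (by decide) fun q k hk => ?_
            have h5 := h₄ q k hk
            have h6 : q = c ∧ k < K + 1 ↔ (q = c ∧ k = K) ∨ (q = c ∧ k < K) := by omega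
            simp only [Program.exec, State.putNat_nat, NExpr.eval_var, NExpr.eval_add,
              NExpr.eval_mul, NExpr.eval_get, f₄.nat nActive rfl, hc₃, f₄.nat nSize rfl, hn₃, hK₄,
              f₄.nat nJ rfl, hJ₃, cell_inj hk hK, true_and, f₄.nat nSets rfl, f₃.nat nSets rfl,
              f₂.nat nSets rfl, f₁.nat nSets rfl, Nat.reduceEqDiff, false_and, if_false, h5, h6]
            by_cases h7 : q = c ∧ k = K
            · simp [h7]
            · simp [h7]
          · rintro s₄ - h₄ q k hk
            simpa [hk] using h₄ q k hk
        intro s₄ f₄ h₄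
        refine Halts.of_straight rfl (by decide) ⟨fun q => if q = c then J else f q, ?_⟩
        have hact : ((Program.setNat nActive 0 (.var nActive + 1)).exec s₄ |>.putNat nJ 0
            (J + 1)).nat nActive 0 = c + 1 := by
          simp [Program.exec, f₄.nat nActive rfl, hc₃]
        rw [hact]
        have hne : ∀ q < c, q ≠ c ∧ f q ≠ J := fun q hq => ⟨hq.ne, (hf q hq).1.ne⟩
        refine ⟨fun q hq => ?_, fun q hq q' hq' h => ?_, fun j hj hS' => ?_⟩
        · have hset : ∀ k < n, ((Program.setNat nActive 0 (.var nActive + 1)).exec s₄ |>.putNat nJ 0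
              (J + 1)).nat nOut (q * n + k) =
              if q = c then s.nat nSets (J * n + k) else s₂.nat nOut (q * n + k) := by
            intro k hk
            simp [Program.exec, h₄ q k hk]
          have hreal : ((Program.setNat nActive 0 (.var nActive + 1)).exec s₄ |>.putNat nJ 0
              (J + 1)).real rOut q = if q = c then s.real rVal J / N else s₂.real rOut q := by
            simp [Program.exec, f₄.real rOut rfl, h₃ q]
          rw [hreal]
          by_cases hqc : q = c
          · simp only [hqc, if_true]
            refine ⟨by omega, trivial, S, hS, fun k => ?_⟩
            rw [← hqc, hset k k.2, if_pos hqc]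
            exact hT.sets J hJ S hS k
          · obtain ⟨h1, h2, S', hS', h3⟩ := hf q (by omega)
            simp only [if_neg hqc]
            refine ⟨by omega, h2, S', hS', fun k => ?_⟩
            rw [hset k k.2, if_neg hqc]
            exact h3 k
        · dsimp only at h
          split_ifs at h with h1 h2 h2
          · omega
          · exact absurd h.symm (hne q' (by omega)).2
          · exact absurd h (hne q (by omega)).2
          · exact hinj q (by omega) q' (by omega) h
        · rcases (by omega : j = J ∨ j < J) with rfl | hj
          · exact ⟨c, by omega, by simp⟩
          · obtain ⟨q, hq, hqj⟩ := hsurj j hj hS'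
            exact ⟨q, by omega, (if_neg hq.ne).trans hqj⟩
      · rw [htest]
        intro hS
        refine (Halts.of_straight (c := 1) rfl (by decide) ⟨f, ?_⟩).time_le (by push_cast; linarith)
        have hact : (Program.skip.exec s₂ |>.putNat nJ 0 (J + 1)).nat nActive 0 = c := by
          simp [Program.exec, hc]
        rw [hact]
        refine ⟨fun q hq => ?_, hinj, fun j hj hS' => ?_⟩
        · obtain ⟨h1, h2, S', hS', h3⟩ := hf q hq
          refine ⟨by omega, by simpa [Program.exec] using h2, S', hS', fun k => ?_⟩
          simpa [Program.exec] using h3 k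
        · rcases (by omega : j = J ∨ j < J) with rfl | hj
          · exact absurd hS' hS
          · exact hsurj j hj hS'
  · rintro s₂ f₂ ⟨f, hf, hinj, hsurj⟩
    refine Halts.of_straight rfl (by decide) ?_
    have hsize : ((Program.setNat nSize 0 (.var nActive)).exec s₂).nat nSize 0 =
        s₂.nat nActive 0 := by simp [Program.exec]
    have hlt : ∀ q : Fin (((Program.setNat nSize 0 (.var nActive)).exec s₂).nat nSize 0),
        q.1 < s₂.nat nActive 0 := fun q => q.2.trans_eq hsize
    have hex : ∀ q : Fin (((Program.setNat nSize 0 (.var nActive)).exec s₂).nat nSize 0),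
        ∃ S, col (f q) = .inl S ∧ s₂.HoldsSet nOut (q * n) S.1 := fun q =>
      (hf q (hlt q)).2.2
    choose S hS hset using hex
    refine ⟨S, fun q q' h => ?_, fun q i => ?_, fun q => ?_, fun S' hS' => ?_⟩
    · refine Fin.ext (hinj q (hlt q) q' (hlt q') ?_)
      exact congrArg Fin.val (hT.col_injective (a₁ := ⟨f q, (hf q (hlt q)).1⟩)
        (a₂ := ⟨f q', (hf q' (hlt q')).1⟩) (by simp only [hS, h]))
    · rw [← hset q i]
      simp [Program.exec]
    · rw [hT.solution_eq N (hf q (hlt q)).1 (hS q), ← (hf q (hlt q)).2.1]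
      simp [Program.exec]
    · refine sum_eq_zero fun j hj => if_neg fun h => hS' ?_
      obtain ⟨q, hq, hqj⟩ := hsurj j (mem_range.1 hj) ⟨S', h⟩
      refine ⟨⟨q, hq.trans_eq hsize.symm⟩, Sum.inl.inj (β := Fin n) ?_⟩
      rw [← hS, ← h, ← hqj]

/-! ### The algorithm -/

/-- Rounds are executed as long as there are active elements. -/
def mainLoop : Program := .while (.natLt 0 (.var nActive)) round

/-- The algorithm for the covering linear program. -/
def algorithm : Program := setup ;; mainLoop ;; slackLoop ;; outputLoop

/-- A bound for the logarithm of the denominator in terms of `X = n / δ`. -/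
theorem clog_le_log {X : ℝ} (hX : 2 ≤ X) {m : ℕ} (hm : (m : ℝ) ≤ 9 * X) :
    (Nat.clog 2 m : ℝ) ≤ 12 * Real.log X := by
  have hlog2 : 1 / 2 < Real.log 2 := by linarith [Real.log_two_gt_d9]
  have hlogX : Real.log 2 ≤ Real.log X := Real.log_le_log (by norm_num) hX
  obtain ⟨L, hL⟩ : ∃ L, Nat.clog 2 m = L := ⟨_, rfl⟩
  rw [hL]
  rcases Nat.eq_zero_or_pos L with rfl | hpos
  · push_cast; linarith
  have h1 : 2 ^ (L - 1) < m := by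
    rw [← Nat.lt_clog_iff_pow_lt (by norm_num), hL]
    omega
  have h2 : (2 : ℝ) ^ (L - 1) ≤ X ^ 5 := by
    calc (2 : ℝ) ^ (L - 1) ≤ m := by exact_mod_cast h1.le
      _ ≤ 9 * X := hm
      _ ≤ 2 ^ 4 * X := by linarith
      _ ≤ X ^ 4 * X := by gcongr
      _ = X ^ 5 := by ring
  have h3 := Real.log_le_log (by positivity) h2
  rw [Real.log_pow, Real.log_pow, Nat.cast_sub hpos] at h3
  push_cast at h3
  nlinarith [(Nat.cast_nonneg L : (0 : ℝ) ≤ L)]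

/-- The sum of the times of the four parts of the algorithm, where `N` is the scale, `T` the time
of the separation subroutine and `τ` the time of the cost subroutine. -/
theorem time_bound {n m L N C₀ δ T τ : ℝ} (hn : 1 ≤ n) (hδ : 0 < δ) (hX : 2 ≤ n / δ)
    (hm1 : 1 ≤ m) (hm : m ≤ 9 * (n / δ)) (hL1 : 1 ≤ L) (hL : L ≤ 12 * Real.log (n / δ))
    (hN : N = m * m * L) (hT : 0 ≤ T) (hC : 0 ≤ C₀) (hτ : τ ≤ C₀ * n) :
    (m + L + n + 3) * 200 + ((n * N + 1) * ((n + 2) * ((n + 2) * 1000) + τ + T + 10) +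
      ((n + 2) * ((n + 2) * ((n + 2) * 1000)) + (n + 2) * ((n + 2) * 200))) ≤
    (1000 * (9010 + C₀) + 50000) * (n ^ 4 / δ ^ 2 * Real.log (n / δ)) * (1 / δ * T + n ^ 2) := by
  obtain ⟨X, hXd⟩ : ∃ X, n / δ = X := ⟨_, rfl⟩
  obtain ⟨l, hl⟩ : ∃ l, Real.log X = l := ⟨_, rfl⟩
  have hl2 : 1 / 2 ≤ l := by
    rw [← hl]
    have := Real.log_le_log (by norm_num) (hXd ▸ hX)
    linarith [Real.log_two_gt_d9]
  rw [hXd] at hX hm hL ⊢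
  rw [hl] at hL ⊢
  have hδX : δ = n / X := by rw [← hXd]; field_simp
  obtain ⟨W, hW⟩ : ∃ W, X ^ 2 * l = W := ⟨_, rfl⟩
  have hn0 : 0 < n := by linarith
  have hX0 : 0 < X := by linarith
  have hXW : X ≤ W := by rw [← hW]; nlinarith [mul_nonneg hX0.le (sub_nonneg.2 hl2)]
  have hlW : l ≤ W := hW ▸ le_mul_of_one_le_left (by linarith) (by nlinarith)
  have hrhs : n ^ 4 / δ ^ 2 * l * (1 / δ * T + n ^ 2) = n * W * X * T + n ^ 4 * W := by
    rw [hδX, ← hW]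
    field_simp
  have hn2 : n ≤ n ^ 2 := by nlinarith
  have hn3 : n ^ 2 ≤ n ^ 3 := by nlinarith [sq_nonneg n]
  have hn4 : n ^ 3 ≤ n ^ 4 := by nlinarith [pow_pos hn0 3]
  have hN1 : n * N + 1 ≤ 1000 * (n * W) := by
    have h1 : N ≤ 972 * W := by
      rw [hN, ← hW]
      calc m * m * L ≤ (9 * X) * (9 * X) * (12 * l) := by gcongr
        _ = 972 * (X ^ 2 * l) := by ring
    have h2 : n * N ≤ n * (972 * W) := by gcongr
    nlinarith [mul_le_mul hn (show (1 : ℝ) ≤ W by linarith) zero_le_one hn0.le]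
  have hround : (n + 2) * ((n + 2) * 1000) + τ + T + 10 ≤ (9010 + C₀) * n ^ 2 + T := by
    have : C₀ * n ≤ C₀ * n ^ 2 := by gcongr
    linarith
  have h1 : (n * N + 1) * ((n + 2) * ((n + 2) * 1000) + τ + T + 10) ≤
      1000 * (9010 + C₀) * (n ^ 4 * W) + 1000 * (n * W * X * T) := by
    calc (n * N + 1) * ((n + 2) * ((n + 2) * 1000) + τ + T + 10)
        ≤ (n * N + 1) * ((9010 + C₀) * n ^ 2 + T) := by
          have : 0 ≤ N := by rw [hN]; positivity
          gcongr
      _ ≤ 1000 * (n * W) * ((9010 + C₀) * n ^ 2 + T) := by gcongr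
      _ = 1000 * (9010 + C₀) * (n ^ 3 * W) + 1000 * (n * W * 1 * T) := by ring
      _ ≤ _ := by
        have hW0 : 0 ≤ W := by linarith
        gcongr
        linarith
  have hnW : n ^ 3 * W ≤ n ^ 4 * W := by
    have hW0 : 0 ≤ W := by linarith
    gcongr
  have hW1 : W ≤ n ^ 4 * W := le_mul_of_one_le_left (by linarith) (by linarith)
  have hn1 : n ^ 4 ≤ n ^ 4 * W := le_mul_of_one_le_right (by positivity) (by linarith)
  have h2 : (m + L + n + 3) * 200 ≤ 6000 * (n ^ 4 * W) := by linarith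
  have h3 : (n + 2) * ((n + 2) * ((n + 2) * 1000)) ≤ 27000 * (n ^ 4 * W) := by
    calc (n + 2) * ((n + 2) * ((n + 2) * 1000)) ≤ (3 * n) * ((3 * n) * ((3 * n) * 1000)) := by
          gcongr <;> linarith
      _ = 27000 * n ^ 3 := by ring
      _ ≤ 27000 * (n ^ 4 * W) := by linarith
  have h4 : (n + 2) * ((n + 2) * 200) ≤ 1800 * (n ^ 4 * W) := by
    calc (n + 2) * ((n + 2) * 200) ≤ (3 * n) * ((3 * n) * 200) := by gcongr <;> linarith
      _ = 1800 * n ^ 2 := by ring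
      _ ≤ 1800 * (n ^ 4 * W) := by linarith
  have h5 : 0 ≤ n * W * X * T := by
    have hW0 : 0 ≤ W := by linarith
    positivity
  rw [mul_assoc (1000 * (9010 + C₀) + 50000), hrhs]
  linarith [mul_nonneg hC h5]

theorem halts_mainLoop {m N L : ℕ} {s : State} (hsep : I.IsDualSeparation O.sep)
    (hfeas : ∃ z, I.IsFeasible z) (hn : 0 < n) (hm : 16 ≤ m) (hN : N = m * m * L)
    (hL : m ≤ 2 ^ L) (hτ : 0 ≤ O.costTime) (hT : 0 ≤ O.sepTime (1 / m))
    (h : MainInv I m N (n * N) s) :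
    Halts O mainLoop s
      ((n * N + 1) * ((n + 2) * ((n + 2) * 1000) + O.costTime + O.sepTime (1 / m) + 10))
      fun s₁ => (∃ r, MainInv I m N r s₁) ∧ s₁.nat nActive 0 = 0 := by
  refine (Halts.whileLoop (MainInv I m N) (by positivity) (fun r s₁ hs₁ hb =>
    halts_round hsep hfeas hn hm hN hL hs₁ (by simpa using hb)) _ s h).mono ?_ ?_
  · have h1 : (BExpr.natLt 0 (.var nActive)).time = 4 := rfl
    have h2 : (0 : ℝ) ≤ n * N := by positivity
    rw [h1]
    push_cast
    nlinarith
  · rintro s₁ - ⟨⟨r, -, hr⟩, hb⟩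
    exact ⟨⟨r, hr⟩, by simpa using hb⟩

/-- The factor `8` in the denominator makes the error `6 n / m` of the three terms in
`CostBounds.few`, divided by `N`, smaller than `δ`. -/
theorem halts_algorithm {m N L : ℕ} {δ : ℝ} (hsep : I.IsDualSeparation O.sep)
    (hfeas : ∃ z, I.IsFeasible z) (hτ : 0 ≤ O.costTime) (hT : 0 ≤ O.sepTime (1 / m))
    (hδ : 0 < δ) (hδn : δ ≤ (n : ℝ) / 2) (hM : m = ⌈8 * (n : ℝ) / δ⌉₊) (hm : 16 ≤ m)
    (hL : L = Nat.clog 2 m) (hN : N = m * m * L) (hN0 : 0 < N) :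
    Halts O algorithm (initState n δ)
      ((m + L + n + 3) * 200 +
        ((n * N + 1) * ((n + 2) * ((n + 2) * 1000) + O.costTime + O.sepTime (1 / m) + 10) +
        ((n + 2) * ((n + 2) * ((n + 2) * 1000)) + (n + 2) * ((n + 2) * 200))))
      fun s => ∃ x, Outputs I s x ∧ I.IsBasicSolution x ∧ I.objective x ≤ I.optF + δ := by
  have hn0 : 0 < n := by
    rcases Nat.eq_zero_or_pos n with rfl | h
    · simp at hδn; linarith
    · exact h
  have hNr : (0 : ℝ) < N := by exact_mod_cast hN0
  have hmL : m ≤ 2 ^ L := hL ▸ Nat.le_pow_clog (by norm_num) m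
  refine (halts_setup hδ hδn hM hL hN hN0 hm).seq fun s₁ _ h₁ => ?_
  refine (halts_mainLoop hsep hfeas hn0 hm hN hmL hτ hT h₁).seq ?_
  rintro s₂ - ⟨⟨r, h₂⟩, hact⟩
  have hcount : ∀ i < n, N ≤ s₂.nat nCount i := by
    intro i hi
    have := h₂.active.symm.trans hact
    rw [numActive, card_eq_zero, filter_eq_empty_iff] at this
    exact not_lt.1 (this (mem_univ (⟨i, hi⟩ : Fin n)))
  refine (halts_slackLoop h₂.scale hcount h₂.tableau).seq ?_
  rintro s₃ f₃ ⟨⟨col, hT₃⟩, htot₃⟩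
  have hscale : s₃.nat nScale 0 = N := by rw [f₃.nat nScale rfl, h₂.scale]
  refine (halts_outputLoop hscale hT₃).mono le_rfl fun s₄ _ h₄ =>
    ⟨_, h₄, hT₃.isBasicSolution hNr, ?_⟩
  rw [hT₃.objective_solution, div_le_iff₀ hNr]
  have hfew := h₂.bounds.few (by rw [← h₂.active, hact, mul_zero]; exact Nat.zero_le n)
  rw [← h₂.active, hact, Nat.cast_zero, mul_zero, add_zero] at hfew
  refine (htot₃.trans hfew).trans ?_
  have hmr : (16 : ℝ) ≤ m := by exact_mod_cast hm
  have hmpos : (0 : ℝ) < m := by linarith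
  have hnr : (1 : ℝ) ≤ n := by exact_mod_cast hn0
  have hmN : (m : ℝ) ≤ N := by
    have : m ≤ N := by
      have hL0 : 0 < L := by
        rw [Nat.pos_iff_ne_zero]
        rintro rfl
        omega
      rw [hN, mul_assoc]
      exact Nat.le_mul_of_pos_right m (by positivity)
    exact_mod_cast this
  have hmδ : 8 * (n / m) ≤ δ := by
    have := Nat.le_ceil (8 * (n : ℝ) / δ)
    rw [← hM, div_le_iff₀ hδ] at this
    rw [← mul_div_assoc, div_le_iff₀ hmpos]
    linarith
  have hopt := CoverInstance.optF_le_card hfeas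
  have h1 : I.optF * N * (4 / m) ≤ 4 * (N * (n / m)) := by
    calc I.optF * N * (4 / m) ≤ n * N * (4 / m) := by gcongr
      _ = _ := by ring
  have h2 : 1 ≤ (N : ℝ) * (n / m) := by
    rw [← mul_div_assoc, le_div_iff₀ hmpos]
    nlinarith
  have h3 : (N : ℝ) * (8 * (n / m)) ≤ N * δ := by gcongr
  nlinarith

/-- The denominator is of the order `n / δ`. -/
theorem ceil_le_mul {n : ℕ} {δ : ℝ} (hδ : 0 < δ) (hδn : δ ≤ (n : ℝ) / 2) :
    (⌈8 * (n : ℝ) / δ⌉₊ : ℝ) ≤ 9 * (n / δ) ∧ 16 ≤ ⌈8 * (n : ℝ) / δ⌉₊ ∧ 2 ≤ n / δ := by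
  have h2 : 2 ≤ n / δ := by rw [le_div_iff₀ hδ]; linarith
  have h8 : 8 * (n : ℝ) / δ = 8 * (n / δ) := by ring
  rw [h8]
  have h0 : 0 ≤ 8 * (n / δ) := by linarith
  refine ⟨by linarith [Nat.ceil_lt_add_one h0], ?_, h2⟩
  have : (16 : ℝ) ≤ (⌈8 * (n / δ)⌉₊ : ℝ) := by linarith [Nat.le_ceil (8 * (n / δ))]
  exact_mod_cast this

end RAM

theorem mainTheorem9 :
    ∃ (P : RAM.Program) (g : ℕ → ℝ → ℚ) (κ : ℝ), 0 < κ ∧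
      (∀ (n : ℕ) (δ : ℝ), 0 < δ → δ ≤ (n : ℝ) / 2 →
        κ * (δ / n) ≤ (g n δ : ℝ) ∧ g n δ < 1) ∧
      ∀ C₀ : ℝ, ∃ C : ℝ,
        ∀ (n : ℕ) (I : CoverInstance n) (T : ℕ → ℚ → ℝ) (τ : ℝ)
          (sep : (Fin n → ℚ) → ℚ → I.Col),
          (∃ z, I.IsFeasible z) →
          (∀ k ε, 0 ≤ T k ε) →
          0 ≤ τ → τ ≤ C₀ * n →
          I.IsDualSeparation sep →
          ∀ δ : ℝ, 0 < δ → δ ≤ (n : ℝ) / 2 →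
            ∃ (t : ℝ) (s : RAM.State) (x : I.Col → ℝ),
              RAM.Run ⟨sep, T n, τ⟩ P (RAM.initState n δ) t s ∧
              t ≤ C * ((n : ℝ) ^ 4 / δ ^ 2 * Real.log (n / δ)) *
                (1 / δ * T n (g n δ) + (n : ℝ) ^ 2) ∧
              RAM.Outputs I s x ∧
              I.IsBasicSolution x ∧
              I.objective x ≤ I.optF + δ := by
  refine ⟨RAM.algorithm, fun n δ => 1 / ⌈8 * (n : ℝ) / δ⌉₊, 1 / 9, by norm_num, ?_, ?_⟩
  · intro n δ hδ hδn
    obtain ⟨hle, h16, -⟩ := RAM.ceil_le_mul hδ hδn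
    have h16' : (16 : ℝ) ≤ ⌈8 * (n : ℝ) / δ⌉₊ := by exact_mod_cast h16
    have h16q : (16 : ℚ) ≤ ⌈8 * (n : ℝ) / δ⌉₊ := by exact_mod_cast h16
    constructor
    · push_cast
      rw [le_div_iff₀ (by linarith)]
      have hnpos : (0 : ℝ) < n := by linarith
      calc 1 / 9 * (δ / n) * (⌈8 * (n : ℝ) / δ⌉₊ : ℝ) ≤ 1 / 9 * (δ / n) * (9 * (n / δ)) := by
            gcongr
        _ = 1 := by field_simp
    · rw [div_lt_one (by linarith)]
      linarith
  · intro C₀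
    refine ⟨1000 * (9010 + |C₀|) + 50000, ?_⟩
    intro n I T τ sep hfeas hT hτ hτC hsep δ hδ hδn
    obtain ⟨hle, h16, h2⟩ := RAM.ceil_le_mul hδ hδn
    dsimp only
    obtain ⟨m, hm⟩ : ∃ m, m = ⌈8 * (n : ℝ) / δ⌉₊ := ⟨_, rfl⟩
    rw [← hm] at hle h16 ⊢
    have hn : (1 : ℝ) ≤ n := by
      rcases Nat.eq_zero_or_pos n with rfl | h
      · simp at hδn; linarith
      · exact_mod_cast h
    have hL1 : 1 ≤ Nat.clog 2 m := Nat.clog_pos (by norm_num) (by omega)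
    obtain ⟨t, s, hrun, ht, x, hout, hbasic, hobj⟩ :=
      RAM.halts_algorithm (O := ⟨sep, T n, τ⟩) hsep hfeas hτ (hT n _) hδ hδn hm h16 rfl rfl
        (by positivity)
    refine ⟨t, s, x, hrun, ht.trans ?_, hout, hbasic, hobj⟩
    refine RAM.time_bound hn hδ h2 (by exact_mod_cast (by omega : 1 ≤ m)) hle
      (by exact_mod_cast hL1) (RAM.clog_le_log h2 hle) (by push_cast; ring) (hT n _)
      (abs_nonneg C₀) (hτC.trans ?_)
    gcongr
    exact le_abs_self C₀
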